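/- Let $\mathcal P$ be a countable set with a map $N:\mathcal P\to\mathbb Z_{>1}$, let $\mathcal M$ be the free abelian monoid on $\mathcal P$, write $\mathfrak m=\sum_{\mathfrak p}n_{\mathfrak p}(\mathfrak m)\,\mathfrak p$ for $\mathfrak m\in\mathcal M$, and put $N(\mathfrak m)=\prod_{\mathfrak p}N(\mathfrak p)^{n_{\mathfrak p}(\mathfrak m)}$ and $\omega(\mathfrak m)=|\{\mathfrak p\in\mathcal P: n_{\mathfrak p}(\mathfrak m)\ge 1\}|$. Let $X\subseteq\mathbb Q$ contain $N(\mathfrak m)$ for every $\mathfrak m\in\mathcal M$ and satisfy $x_1/x_2\in X$ for all $x_1,x_2\in X$ with $x_2\neq 0$ (for instance $X=\mathbb Q$, or $X=\{q^z:z\in\mathbb Z\}$ with an integer $q\ge 2$ when all norms are powers of $q$). Assume that there are $\kappa>0$ and $0\le\theta<1$ such that, as $x\to\infty$ in $X$, $$|\{\mathfrak m\in\mathcal M: N(\mathfrak m)\le x\}|=\kappa x+O(x^\theta),\tag{$\star$}$$ the sets on the left being finite for $x \in X$. Let $h\ge 2$ be an integer, and let $\mathcal N_h(x)$ be the set of $h$-full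 elements of norm at most $x$, that is, of those $\mathfrak m\in\mathcal M$ with $N(\mathfrak m)\le x$ such that $n_{\mathfrak p}(\mathfrak m)\ge h$ whenever $n_{\mathfrak p}(\mathfrak m)\ge 1$. Then for every $a\in\mathbb R$, $$\lim_{\substack{x\to\infty\\ x\in X}}\frac1{|\mathcal N_h(x)|}\left|\left\{\mathfrak m\in\mathcal N_h(x): N(\mathfrak m)\ge 3,\ \frac{\omega(\mathfrak m)-\log\log N(\mathfrak m)}{\sqrt{\log\log N(\mathfrak m)}}\le a\right\}\right|=\frac1{\sqrt{2\pi}}\int_{-\infty}^a e^{-u^2/2}\,du.$$ Moreover, the product $$\gamma_h=\prod_{\mathfrak p\in\mathcal P}\left(1+\frac{N(\mathfrak p)-N(\mathfrak p)^{1/h}}{N(\mathfrak p)^2\left(N(\mathfrak p)^{1/h}-1\right)}\right)$$ converges unconditionally, and if $X=\mathbb Q$, then $|\mathcal N_h(x)|\sim\kappa\gamma_h x^{1/h}$ as $x\to\infty$. -/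

import Mathlib

open Filter Topology Asymptotics

namespace ErdosKacMonoid

variable {P : Type*}

/-- The free abelian monoid `M` generated by the prime elements `P`, written additively:
`m p` is the multiplicity of the prime element `p` in `m`. -/
abbrev FreeAbMonoid (P : Type*) : Type _ := P →₀ ℕ

/-- The extension of a norm map on `P` to the monoid: the product of `N p ^ (m p)`. -/
def mnorm (N : P → ℕ) (m : FreeAbMonoid P) : ℕ := m.prod fun p k => N p ^ k

/-- The number of prime elements occurring in `m`, counted without multiplicity. -/
def omega (m : FreeAbMonoid P) : ℕ := m.support.card

/-- The elements of `M` of norm at most `x`. -/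
def elementsUpTo (N : P → ℕ) (x : ℚ) : Set (FreeAbMonoid P) := {m | (mnorm N m : ℚ) ≤ x}

/-- `m` is `h`-full: every prime element occurring in `m` has multiplicity at least `h`. -/
def IsFull (h : ℕ) (m : FreeAbMonoid P) : Prop := ∀ p : P, m p ≠ 0 → h ≤ m p

/-- The `h`-full elements of norm at most `x`. -/
def fullUpTo (N : P → ℕ) (h : ℕ) (x : ℚ) : Set (FreeAbMonoid P) :=
  {m | IsFull h m ∧ (mnorm N m : ℚ) ≤ x}

/-- The filter `x → ∞` with `x` restricted to `X`. -/
def toInfinity (X : Set ℚ) : Filter ℚ := atTop ⊓ 𝓟 X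

/-- The set `X` of admissible values: it contains all norms and is closed under quotients. -/
structure IsAdmissible (N : P → ℕ) (X : Set ℚ) : Prop where
  norm_mem : ∀ m : FreeAbMonoid P, (mnorm N m : ℚ) ∈ X
  div_mem : ∀ x₁ ∈ X, ∀ x₂ ∈ X, x₂ ≠ 0 → x₁ / x₂ ∈ X

/-- The counting condition: there are finitely many elements of norm at most `x`, namely
`κ x + O(x ^ θ)` as `x → ∞` in `X`, where `κ > 0` and `0 ≤ θ < 1`. -/
structure Star (N : P → ℕ) (X : Set ℚ) (κ θ : ℝ) : Prop where
  kappa_pos : 0 < κ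
  theta_nonneg : 0 ≤ θ
  theta_lt_one : θ < 1
  finite : ∀ x ∈ X, (elementsUpTo N x).Finite
  count : (fun x : ℚ => ((elementsUpTo N x).ncard : ℝ) - κ * (x : ℝ))
    =O[toInfinity X] fun x : ℚ => (x : ℝ) ^ θ

/-- The standard Gaussian distribution function. -/
noncomputable def gaussianCDF (a : ℝ) : ℝ :=
  1 / Real.sqrt (2 * Real.pi) * ∫ u in Set.Iic a, Real.exp (-u ^ 2 / 2)

/-- The local factor at `p` of the constant `γ_h`. -/
noncomputable def gammaFactor (N : P → ℕ) (h : ℕ) (p : P) : ℝ :=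
  1 + ((N p : ℝ) - (N p : ℝ) ^ (1 / (h : ℝ))) /
    ((N p : ℝ) ^ 2 * ((N p : ℝ) ^ (1 / (h : ℝ)) - 1))

/-- The constant `γ_h`, the product over all prime elements of the local factors. -/
noncomputable def gammaConst (N : P → ℕ) (h : ℕ) : ℝ := ∏' p : P, gammaFactor N h p

/-- The deviation of `ω(m)` from `log log N(m)` in units of `√(log log N(m))`. -/
noncomputable def deviation (N : P → ℕ) (m : FreeAbMonoid P) : ℝ :=
  ((omega m : ℝ) - Real.log (Real.log (mnorm N m : ℝ))) /
    Real.sqrt (Real.log (Real.log (mnorm N m : ℝ)))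

end ErdosKacMonoid

/-! Each `h`-full element is uniquely `h • a + b` with the nonzero exponents of `b` strictly between
`h` and `2 * h` (`rest`, `ncard_full_eq_tsum`), and for given `b` the element `a` is constrained
only by N(a) ≤ (x / N(b))^(1/h). The weights N(b)^(-1/h) form a convergent series, because its Euler
product involves only exponents k/h > 1; its sum is `gammaConst`. Passing from `a` to `h • a + b`
with `b` fixed changes ω by at most ω(b) and, for all but a negligible proportion of the `a`,
changes log log of the norm by O(1) relative to log log of the bound on N(a). So the Erdős–Kac law
for the whole monoid holds along each `b` (`tendsto_card_deviation_le`), and dominated convergence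
sums over `b`.

The law for the whole monoid (`tendsto_card_omega_le`) comes from characteristic functions. Write l
= log log x and keep only the primes T of norm at most y, where log y = log x / l. With v =
exp(it/√l) - 1, the exponential of it ω_T(m)/√l is ∏ (1 + v 1_{p ∣ m}) over T. Expand over subsets S
of T and apply the counting condition at x / N(S), a point of `X` by closure under quotients. The
main term is κx times the characteristic function of a sum of independent Bernoulli variables of
parameters 1/N(p), which is Gaussian in the limit (`tendsto_prod_bernoulli`). In the error, the
exponent 1 - l / log x saves a factor log x, while the product over T costs only exp(O(√l))
(`tendsto_truncation_error`). The omitted primes contribute O(log l) to ω on average, which is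
o(√l).

The only information needed on the primes is ∑ 1/N(p) = l + O(log l), a weak Mertens theorem. It
follows from two-sided linear bounds for the counting function (`exists_loglog_le_primeSum`,
`exists_primeSum_le`). -/

namespace ErdosKacMonoid

/-! ### Norms, squarefree elements and counting functions -/

section Norm

variable {P : Type*} {N : P → ℕ}

lemma mnorm_zero : mnorm N 0 = 1 := by simp [mnorm]

lemma mnorm_add (a b : FreeAbMonoid P) : mnorm N (a + b) = mnorm N a * mnorm N b := by
  classical
  exact Finsupp.prod_add_index' (by simp) (fun p m n => pow_add _ _ _)

lemma mnorm_nsmul (n : ℕ) (a : FreeAbMonoid P) : mnorm N (n • a) = mnorm N a ^ n := by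
  induction n with
  | zero => simp [mnorm_zero]
  | succ k ih => rw [succ_nsmul, mnorm_add, ih, pow_succ]

lemma mnorm_single (p : P) (k : ℕ) : mnorm N (Finsupp.single p k) = N p ^ k := by
  simp [mnorm]

lemma mnorm_pos (hN : ∀ p, 1 < N p) (m : FreeAbMonoid P) : 0 < mnorm N m :=
  Finset.prod_pos fun p _ => pow_pos (by have := hN p; omega) _

lemma one_le_mnorm (hN : ∀ p, 1 < N p) (m : FreeAbMonoid P) : (1 : ℝ) ≤ mnorm N m := by
  exact_mod_cast mnorm_pos hN m

/-- The squarefree element with a given finite support. -/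
noncomputable def radical (S : Finset P) : FreeAbMonoid P := Finsupp.indicator S fun _ _ => 1

lemma radical_apply [DecidableEq P] (S : Finset P) (p : P) :
    radical S p = if p ∈ S then 1 else 0 := by
  classical
  simp [radical, Finsupp.indicator_apply]

lemma support_radical (S : Finset P) : (radical S).support = S := by
  classical
  ext p
  simp [radical_apply]

lemma mnorm_radical (S : Finset P) : mnorm N (radical S) = ∏ p ∈ S, N p := by
  classical
  rw [mnorm, Finsupp.prod, support_radical]
  exact Finset.prod_congr rfl fun p hp => by simp [radical_apply, hp]

lemma radical_injective : Function.Injective (radical : Finset P → FreeAbMonoid P) := fun S T h => by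
  rw [← support_radical S, h, support_radical]

/-- The finite set of elements of norm at most `z`. -/
noncomputable def elts (N : P → ℕ) (z : ℝ) : Finset (FreeAbMonoid P) :=
  open Classical in
  if h : {m : FreeAbMonoid P | (mnorm N m : ℝ) ≤ z}.Finite then h.toFinset else ∅

/-- The finite set of prime elements of norm at most `z`. -/
noncomputable def primesLe (N : P → ℕ) (z : ℝ) : Finset P :=
  open Classical in
  if h : {p : P | (N p : ℝ) ≤ z}.Finite then h.toFinset else ∅

/-- The number of elements of norm at most `z`. -/
noncomputable def cnt (N : P → ℕ) (z : ℝ) : ℝ := (elts N z).card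

/-- There are finitely many elements of bounded norm. -/
def LocallyFinite (N : P → ℕ) : Prop := ∀ z : ℝ, {m : FreeAbMonoid P | (mnorm N m : ℝ) ≤ z}.Finite

lemma LocallyFinite.mem_elts (hf : LocallyFinite N) {z : ℝ} {m : FreeAbMonoid P} :
    m ∈ elts N z ↔ (mnorm N m : ℝ) ≤ z := by
  rw [elts, dif_pos (hf z)]; simp

lemma LocallyFinite.finite_primes (hf : LocallyFinite N) (z : ℝ) : {p : P | (N p : ℝ) ≤ z}.Finite := by
  have : Set.InjOn (fun p : P => (Finsupp.single p 1 : FreeAbMonoid P))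
      ((fun p : P => (Finsupp.single p 1 : FreeAbMonoid P)) ⁻¹' {m | (mnorm N m : ℝ) ≤ z}) :=
    fun p _ q _ h => Finsupp.single_left_injective one_ne_zero h
  refine ((hf z).preimage this).subset fun p hp => ?_
  simpa [mnorm_single] using hp

lemma LocallyFinite.mem_primesLe (hf : LocallyFinite N) {z : ℝ} {p : P} :
    p ∈ primesLe N z ↔ (N p : ℝ) ≤ z := by
  rw [primesLe, dif_pos (hf.finite_primes z)]; simp

lemma cnt_nonneg (z : ℝ) : 0 ≤ cnt N z := Nat.cast_nonneg _

lemma LocallyFinite.cnt_mono (hf : LocallyFinite N) {z w : ℝ} (h : z ≤ w) : cnt N z ≤ cnt N w := by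
  refine Nat.cast_le.2 (Finset.card_le_card fun m hm => ?_)
  rw [hf.mem_elts] at *
  exact hm.trans h

lemma LocallyFinite.cnt_eq_zero (hf : LocallyFinite N) (hN : ∀ p, 1 < N p) {z : ℝ} (h : z < 1) :
    cnt N z = 0 := by
  simp only [cnt, Nat.cast_eq_zero, Finset.card_eq_zero]
  refine Finset.eq_empty_of_forall_notMem fun m hm => ?_
  have := one_le_mnorm hN m
  rw [hf.mem_elts] at hm
  linarith

lemma LocallyFinite.one_le_cnt (hf : LocallyFinite N) {z : ℝ} (h : 1 ≤ z) : 1 ≤ cnt N z := by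
  have : (0 : FreeAbMonoid P) ∈ elts N z := by simpa [hf.mem_elts, mnorm_zero] using h
  exact Nat.one_le_cast.2 (Finset.card_pos.2 ⟨_, this⟩)

lemma LocallyFinite.cnt_floor (hf : LocallyFinite N) {z : ℝ} (hz : 0 ≤ z) :
    cnt N (⌊z⌋₊ : ℝ) = cnt N z := by
  rw [cnt, cnt]
  congr 2
  ext m
  rw [hf.mem_elts, hf.mem_elts, Nat.cast_le, Nat.le_floor_iff hz]

end Norm

/-! ### The counting condition along `X` and its extension to real arguments -/

section Counting

variable {P : Type*} {N : P → ℕ} {X : Set ℚ} {κ θ : ℝ}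

lemma isLittleO_rpow_id {e : ℝ} (he : e < 1) :
    (fun x : ℝ => x ^ e) =o[atTop] fun x : ℝ => x := by
  have h := tendsto_rpow_neg_atTop (sub_pos.2 he)
  refine (isLittleO_iff_tendsto' ?_).2 (h.congr' ?_)
  · filter_upwards [eventually_ne_atTop 0] with x hx h using absurd h hx
  · filter_upwards [eventually_gt_atTop 0] with x hx
    rw [neg_sub, Real.rpow_sub hx, Real.rpow_one]

/-- Without primes the monoid is a single point, so its count cannot grow like κx; hence `X` must be
bounded above. This settles the degenerate case of the theorem. -/
lemma isEmpty_imp_toInfinity_eq_bot [IsEmpty P] (hstar : Star N X κ θ) : toInfinity X = ⊥ := by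
  by_contra hne
  have : NeBot (toInfinity X) := ⟨hne⟩
  have hlim : Tendsto (fun x : ℚ => (x : ℝ)) (toInfinity X) atTop :=
    tendsto_ratCast_atTop_iff.2 (tendsto_id.mono_left inf_le_left)
  have h1 := (isLittleO_rpow_id hstar.theta_lt_one).comp_tendsto hlim
  have h2 : (fun _ : ℚ => (1 : ℝ)) =o[toInfinity X] fun x : ℚ => (x : ℝ) :=
    (isLittleO_const_id_atTop (1 : ℝ)).comp_tendsto hlim
  have h3 : (fun x : ℚ => ((elementsUpTo N x).ncard : ℝ)) =o[toInfinity X] fun x : ℚ => (x : ℝ) := by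
    refine IsBigO.trans_isLittleO (IsBigO.of_bound 1 (Eventually.of_forall fun x => ?_)) h2
    have : (elementsUpTo N x).ncard ≤ 1 := (Set.ncard_le_one (Set.toFinite _)).2 fun a _ b _ => Subsingleton.elim a b
    simpa using this
  have h4 : (fun x : ℚ => κ * (x : ℝ)) =o[toInfinity X] fun x : ℚ => (x : ℝ) := by
    simpa using h3.sub (hstar.count.trans_isLittleO h1)
  have h5 : (fun x : ℚ => (x : ℝ)) =o[toInfinity X] fun x : ℚ => (x : ℝ) :=
    (isLittleO_const_mul_left_iff hstar.kappa_pos.ne').1 h4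
  exact isLittleO_irrefl ((hlim.eventually_ne_atTop 0).frequently) h5

lemma tendsto_toInfinity_cast : Tendsto (fun x : ℚ => (x : ℝ)) (toInfinity X) atTop :=
  tendsto_ratCast_atTop_iff.2 (tendsto_id.mono_left inf_le_left)

lemma eventually_mem_toInfinity : ∀ᶠ x in toInfinity X, x ∈ X :=
  eventually_inf_principal.2 (Eventually.of_forall fun _ h => h)

/-- Powers of one prime have unbounded norms, all lying in `X`, so finiteness at points of `X` is
finiteness everywhere. -/
lemma Star.locallyFinite (hN : ∀ p, 1 < N p) (hX : IsAdmissible N X) (hstar : Star N X κ θ)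
    (p₀ : P) : LocallyFinite N := fun z => by
  obtain ⟨k, hk⟩ := pow_unbounded_of_one_lt z (Nat.one_lt_cast.2 (hN p₀) : (1 : ℝ) < N p₀)
  refine (hstar.finite _ (hX.norm_mem (Finsupp.single p₀ k))).subset fun m hm => ?_
  rw [Set.mem_ofPred_eq] at hm
  have : (mnorm N m : ℝ) ≤ (mnorm N (Finsupp.single p₀ k) : ℝ) := by
    rw [mnorm_single]; push_cast; linarith
  simp only [elementsUpTo, Set.mem_ofPred_eq]
  exact_mod_cast this

lemma LocallyFinite.ncard_elementsUpTo (hf : LocallyFinite N) (x : ℚ) :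
    ((elementsUpTo N x).ncard : ℝ) = cnt N x := by
  have : elementsUpTo N x = (elts N x : Set (FreeAbMonoid P)) := by
    ext m
    rw [Finset.mem_coe, hf.mem_elts, elementsUpTo, Set.mem_ofPred_eq]
    exact_mod_cast Iff.rfl
  rw [this, Set.ncard_coe_finset, cnt]

/-- The counting estimate, valid for all positive `x` in `X` and all larger exponents up to `1`. -/
lemma Star.abs_cnt_sub_le (hN : ∀ p, 1 < N p) (hstar : Star N X κ θ) (hf : LocallyFinite N) :
    ∃ C : ℝ, 0 < C ∧ ∀ x ∈ X, 0 < x → ∀ e : ℝ, θ ≤ e → e ≤ 1 →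
      |cnt N x - κ * x| ≤ C * (x : ℝ) ^ e := by
  obtain ⟨C, hC0, hC⟩ := hstar.count.exists_pos
  rw [IsBigOWith, toInfinity, eventually_inf_principal] at hC
  obtain ⟨x₀, hx₀⟩ := eventually_atTop.1 hC
  have hκ := hstar.kappa_pos
  -- The three summands serve the three ranges: `C` for x ≥ x₀, `κ` for x < 1, where the count
  -- vanishes and x ≤ x^e, and the last for the bounded range between, where x^e ≥ 1.
  refine ⟨C + κ + (cnt N (|x₀| : ℝ) + κ * |(x₀ : ℝ)|), by have := cnt_nonneg (N := N) |(x₀ : ℝ)|; positivity,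
    fun x hx h0 e he he1 => ?_⟩
  have hxr : (0 : ℝ) < x := by exact_mod_cast h0
  have hpow : 0 ≤ (x : ℝ) ^ e := by positivity
  have hD0 : 0 ≤ cnt N (|x₀| : ℝ) + κ * |(x₀ : ℝ)| := by have := cnt_nonneg (N := N) |(x₀ : ℝ)|; positivity
  rcases lt_or_ge (x : ℝ) 1 with h1 | h1
  · rw [hf.cnt_eq_zero hN h1, zero_sub, abs_neg, abs_of_pos (by positivity)]
    have : (x : ℝ) ≤ (x : ℝ) ^ e := by
      simpa using Real.rpow_le_rpow_of_exponent_ge hxr h1.le he1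
    nlinarith [mul_nonneg hC0.le hpow, mul_nonneg hD0 hpow, mul_le_mul_of_nonneg_left this hκ.le]
  · rcases le_or_gt x₀ x with h2 | h2
    · have := hx₀ x h2 hx
      rw [hf.ncard_elementsUpTo, Real.norm_eq_abs, Real.norm_of_nonneg (by positivity)] at this
      have h3 : (x : ℝ) ^ θ ≤ (x : ℝ) ^ e := Real.rpow_le_rpow_of_exponent_le h1 he
      nlinarith [mul_nonneg hκ.le hpow, mul_nonneg hD0 hpow, mul_le_mul_of_nonneg_left h3 hC0.le]
    · have h3 : (1 : ℝ) ≤ (x : ℝ) ^ e := Real.one_le_rpow h1 (hstar.theta_nonneg.trans he)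
      have h4 : (x : ℝ) ≤ |(x₀ : ℝ)| := le_trans (by exact_mod_cast h2.le) (le_abs_self _)
      have h5 := hf.cnt_mono h4
      have h6 : |cnt N x - κ * x| ≤ cnt N (|x₀| : ℝ) + κ * |(x₀ : ℝ)| := by
        refine (abs_sub _ _).trans ?_
        rw [abs_of_nonneg (cnt_nonneg _), abs_of_nonneg (by positivity)]
        gcongr
      nlinarith [mul_nonneg hκ.le hpow, mul_nonneg hC0.le hpow]

/-- Every real `z ≥ 1` lies just above a largest norm. -/
lemma LocallyFinite.exists_max_norm (hf : LocallyFinite N) (hN : ∀ p, 1 < N p) (p₀ : P) {z : ℝ}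
    (hz : 1 ≤ z) : ∃ m₀ : FreeAbMonoid P, (mnorm N m₀ : ℝ) ≤ z ∧ z < mnorm N m₀ * N p₀ ∧
      elts N (mnorm N m₀) = elts N z := by
  have hne : (elts N z).Nonempty := ⟨0, by simpa [hf.mem_elts, mnorm_zero] using hz⟩
  obtain ⟨m₀, hm₀, hmax⟩ := Finset.exists_max_image _ (fun m => mnorm N m) hne
  rw [hf.mem_elts] at hm₀
  refine ⟨m₀, hm₀, ?_, ?_⟩
  -- Otherwise adding `p₀` to `m₀` would give a larger norm still at most `z`.
  · by_contra! hle
    have h1 : m₀ + Finsupp.single p₀ 1 ∈ elts N z := by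
      rw [hf.mem_elts, mnorm_add, mnorm_single]; push_cast; simpa using hle
    have h2 := hmax _ h1
    rw [mnorm_add, mnorm_single, pow_one] at h2
    nlinarith [hN p₀, mnorm_pos hN m₀]
  · ext m
    rw [hf.mem_elts]
    exact ⟨fun h => hf.mem_elts.2 (h.trans hm₀), fun h => Nat.cast_le.2 (hmax m h)⟩

/-- Real arguments can be replaced by arguments in `X` without changing the elements counted. -/
lemma LocallyFinite.exists_norm_floor (hf : LocallyFinite N) (hN : ∀ p, 1 < N p)
    (hX : IsAdmissible N X) (p₀ : P) :
    ∃ ν : ℝ → ℚ, (∀ z, 1 ≤ z → elts N (ν z) = elts N z) ∧ Tendsto ν atTop (toInfinity X) := by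
  choose! g hg1 hg2 hg3 using fun z (hz : 1 ≤ z) => hf.exists_max_norm hN p₀ hz
  refine ⟨fun z => mnorm N (g z), fun z hz => by simpa using hg3 z hz, ?_⟩
  refine tendsto_inf.2 ⟨?_, tendsto_principal.2 (Eventually.of_forall fun z => hX.norm_mem _)⟩
  rw [← tendsto_ratCast_atTop_iff (R := ℝ)]
  have hp : (0 : ℝ) < N p₀ := by exact_mod_cast (hN p₀).pos
  refine tendsto_atTop_mono' _ ?_ (tendsto_id.atTop_div_const hp)
  filter_upwards [eventually_ge_atTop 1] with z hz
  have := hg2 z hz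
  rw [id, div_le_iff₀ hp]
  simpa using this.le

/-- The count at a real `z` equals the count at the largest norm below `z`, which is a point of `X`;
there the error term with exponent 1 is enough. -/
lemma Star.cnt_le (hN : ∀ p, 1 < N p) (hX : IsAdmissible N X) (hstar : Star N X κ θ)
    (p₀ : P) : ∃ C : ℝ, 0 < C ∧ ∀ z : ℝ, 0 ≤ z → cnt N z ≤ C * z := by
  have hf := hstar.locallyFinite hN hX p₀
  obtain ⟨C, hC0, hC⟩ := hstar.abs_cnt_sub_le hN hf
  have hκ := hstar.kappa_pos
  refine ⟨C + κ, by positivity, fun z hz => ?_⟩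
  rcases lt_or_ge z 1 with h1 | h1
  · rw [hf.cnt_eq_zero hN h1]; positivity
  · obtain ⟨m, hm1, -, hm3⟩ := hf.exists_max_norm hN p₀ h1
    have := hC _ (hX.norm_mem m) (by exact_mod_cast mnorm_pos hN m) 1 hstar.theta_lt_one.le le_rfl
    rw [Real.rpow_one, Rat.cast_natCast] at this
    have h2 := (abs_le.1 this).2
    rw [cnt, hm3, ← cnt] at h2
    nlinarith

lemma Star.tendsto_cnt_div (hstar : Star N X κ θ) (hf : LocallyFinite N) :
    Tendsto (fun x : ℚ => cnt N x / x) (toInfinity X) (𝓝 κ) := by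
  have h1 := (isLittleO_rpow_id hstar.theta_lt_one).comp_tendsto
    (tendsto_toInfinity_cast (X := X))
  have h2 := (hstar.count.trans_isLittleO h1).tendsto_div_nhds_zero
  have h3 := h2.add_const κ
  rw [zero_add] at h3
  refine h3.congr' ?_
  filter_upwards [tendsto_toInfinity_cast.eventually_gt_atTop 0] with x hx
  simp only [Function.comp_apply, hf.ncard_elementsUpTo]
  field_simp
  ring

/-- Here the gap between `z` and the largest norm below it matters: it is at most a factor N(p₀),
which is lost in the constant. For bounded norms the zero element alone suffices. -/
lemma Star.le_cnt (hN : ∀ p, 1 < N p) (hX : IsAdmissible N X) (hstar : Star N X κ θ)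
    (p₀ : P) : ∃ c : ℝ, 0 < c ∧ ∀ z : ℝ, 1 ≤ z → c * z ≤ cnt N z := by
  have hf := hstar.locallyFinite hN hX p₀
  have hκ := hstar.kappa_pos
  have hp : (1 : ℝ) < N p₀ := by exact_mod_cast hN p₀
  have h1 := (hstar.tendsto_cnt_div hf).eventually_const_lt (half_lt_self hκ)
  rw [toInfinity, eventually_inf_principal] at h1
  obtain ⟨x₀, hx₀⟩ := eventually_atTop.1 h1
  set w : ℝ := max 1 (x₀ : ℝ)
  have hw : 1 ≤ w := le_max_left _ _
  refine ⟨min (κ / 2 / N p₀) (1 / (w * N p₀)), by positivity, fun z hz => ?_⟩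
  obtain ⟨m, hm1, hm2, hm3⟩ := hf.exists_max_norm hN p₀ hz
  have hm0 := one_le_mnorm hN m
  rcases le_or_gt w (mnorm N m) with h | h
  · have h2 := hx₀ (mnorm N m) (by exact_mod_cast (le_max_right _ _).trans h) (hX.norm_mem m)
    rw [Rat.cast_natCast, lt_div_iff₀ (by linarith), cnt, hm3, ← cnt] at h2
    refine le_trans ?_ h2.le
    calc _ ≤ κ / 2 / N p₀ * z := by gcongr; exact min_le_left _ _
      _ ≤ κ / 2 / N p₀ * (mnorm N m * N p₀) := by gcongr
      _ = _ := by field_simp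
  · refine le_trans ?_ (hf.one_le_cnt hz)
    calc _ ≤ 1 / (w * N p₀) * z := by gcongr; exact min_le_right _ _
      _ ≤ 1 / (w * N p₀) * (w * N p₀) := by gcongr; exact hm2.le.trans (by gcongr)
      _ = 1 := by field_simp

end Counting

end ErdosKacMonoid

/-! ### A weak Mertens theorem for the primes of the monoid -/

namespace ErdosKacMonoid

section RealSums

lemma sum_rpow_neg_le {s : ℝ} (hs : 1 < s) (K : ℕ) :
    ∑ n ∈ Finset.Ico 1 K, (n : ℝ) ^ (-s) ≤ s / (s - 1) := by
  have hs1 : 0 < s - 1 := by linarith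
  -- Comparison with the integral of t^(-s), done as an induction; the term (K + 1)^(1 - s) must be
  -- retained for the induction to close.
  have key : ∀ K : ℕ, ∑ n ∈ Finset.Ico 1 (K + 2), (n : ℝ) ^ (-s) ≤
      1 + (1 - ((K : ℝ) + 1) ^ (1 - s)) / (s - 1) := by
    intro K
    induction K with
    | zero => simp
    | succ k ih =>
      rw [Finset.sum_Ico_succ_top (by omega)]
      have hk : (0 : ℝ) < k + 1 := by positivity
      have hk2 : (0 : ℝ) < k + 2 := by positivity
      have h1 : Real.log (k + 1) ≤ Real.log (k + 2) - 1 / (k + 2) := by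
        have := Real.log_le_sub_one_of_pos (div_pos hk hk2)
        rw [Real.log_div hk.ne' hk2.ne'] at this
        have h2 : ((k : ℝ) + 1) / (k + 2) - 1 = -(1 / (k + 2)) := by field_simp; ring
        linarith
      have h2 : ((k : ℝ) + 2) ^ (1 - s) * (1 + (s - 1) / (k + 2)) ≤ ((k : ℝ) + 1) ^ (1 - s) := by
        rw [Real.rpow_def_of_pos hk, Real.rpow_def_of_pos hk2]
        calc _ ≤ Real.exp (Real.log (k + 2) * (1 - s)) * Real.exp ((s - 1) / (k + 2)) := by
              gcongr
              linarith [Real.add_one_le_exp ((s - 1) / ((k : ℝ) + 2))]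
          _ ≤ _ := by
              rw [← Real.exp_add, Real.exp_le_exp]
              have : (s - 1) / ((k : ℝ) + 2) = (s - 1) * (1 / (k + 2)) := by ring
              nlinarith
      have h3 : ((k : ℝ) + 2) ^ (1 - s) * ((s - 1) / (k + 2)) = (s - 1) * ((k : ℝ) + 2) ^ (-s) := by
        rw [show (1 - s) = 1 + -s by ring, Real.rpow_add hk2, Real.rpow_one]
        field_simp
      have h4 : ((k + 2 : ℕ) : ℝ) ^ (-s) ≤
          (((k : ℝ) + 1) ^ (1 - s) - ((k : ℝ) + 2) ^ (1 - s)) / (s - 1) := by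
        rw [le_div_iff₀ hs1]; push_cast; nlinarith
      push_cast at *
      rw [show (k : ℝ) + 1 + 1 = k + 2 by ring]
      rw [show (1 - ((k : ℝ) + 2) ^ (1 - s)) / (s - 1) = (1 - ((k : ℝ) + 1) ^ (1 - s)) / (s - 1) +
        (((k : ℝ) + 1) ^ (1 - s) - ((k : ℝ) + 2) ^ (1 - s)) / (s - 1) by ring]
      linarith
  calc _ ≤ ∑ n ∈ Finset.Ico 1 (K + 2), (n : ℝ) ^ (-s) :=
        Finset.sum_le_sum_of_subset_of_nonneg (Finset.Ico_subset_Ico le_rfl (by omega))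
          fun _ _ _ => by positivity
    _ ≤ _ := key K
    _ ≤ 1 + 1 / (s - 1) := by
        gcongr
        have : 0 ≤ ((K : ℝ) + 1) ^ (1 - s) := by positivity
        linarith
    _ = _ := by field_simp; ring

/-- The dyadic block has M terms, each at least (2M)^(-(s + 1)), and 2^(s + 1) ≤ 8. This spreads one
term of a Dirichlet series over integers, as a discrete partial summation. -/
lemma rpow_neg_le_sum {s : ℝ} (hs : 0 < s) (hs2 : s ≤ 2) {M : ℕ} (hM : 0 < M) :
    (M : ℝ) ^ (-s) ≤ 8 * ∑ n ∈ Finset.Ico M (2 * M), (n : ℝ) ^ (-(s + 1)) := by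
  have hM' : (0 : ℝ) < M := by exact_mod_cast hM
  have h1 : (M : ℝ) * (2 * M : ℝ) ^ (-(s + 1)) ≤
      ∑ n ∈ Finset.Ico M (2 * M), (n : ℝ) ^ (-(s + 1)) := by
    have := Finset.card_nsmul_le_sum (Finset.Ico M (2 * M)) (fun n : ℕ => (n : ℝ) ^ (-(s + 1)))
      ((2 * M : ℝ) ^ (-(s + 1))) fun n hn => by
        rw [Finset.mem_Ico] at hn
        have h0 : (0 : ℝ) < n := by exact_mod_cast (lt_of_lt_of_le hM hn.1)
        exact Real.rpow_le_rpow_of_nonpos h0 (by exact_mod_cast hn.2.le) (by linarith)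
    rw [Nat.card_Ico, nsmul_eq_mul, show 2 * M - M = M by omega] at this
    exact this
  have h2 : (M : ℝ) * (2 * M : ℝ) ^ (-(s + 1)) = (2 : ℝ) ^ (-(s + 1)) * (M : ℝ) ^ (-s) := by
    rw [Real.mul_rpow (by norm_num) hM'.le, show -s = 1 + -(s + 1) by ring,
      Real.rpow_add hM', Real.rpow_one]
    ring
  have h3 : (1 / 8 : ℝ) ≤ (2 : ℝ) ^ (-(s + 1)) := by
    calc (1 / 8 : ℝ) = (2 : ℝ) ^ (-3 : ℝ) := by
          rw [Real.rpow_neg (by norm_num)]; norm_num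
      _ ≤ _ := Real.rpow_le_rpow_of_exponent_le (by norm_num) (by linarith)
  have h4 : 0 ≤ (M : ℝ) ^ (-s) := by positivity
  nlinarith

end RealSums

variable {P : Type*} {N : P → ℕ}

/-- Partial summation: after the sums are exchanged, the inner one counts elements of norm at most
n. The explicit 1/(s - 1), the order of the pole of the zeta function, is what the later prime sums
exploit. -/
lemma exists_sum_rpow_neg_le (hN : ∀ p, 1 < N p) (hf : LocallyFinite N) {C : ℝ}
    (hC : ∀ z : ℝ, 0 ≤ z → cnt N z ≤ C * z) {s : ℝ} (hs : 1 < s) (hs2 : s ≤ 2)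
    (F : Finset (FreeAbMonoid P)) : ∑ m ∈ F, (mnorm N m : ℝ) ^ (-s) ≤ 16 * C / (s - 1) := by
  have hC0 : 0 ≤ C := by simpa using (cnt_nonneg (N := N) 1).trans (hC 1 zero_le_one)
  -- Large enough that each block from N(m) to 2N(m) lies below `K`.
  set K : ℕ := F.sup (fun m => 2 * mnorm N m)
  have hK : ∀ m ∈ F, 2 * mnorm N m ≤ K := fun m hm =>
    Finset.le_sup (f := fun m => 2 * mnorm N m) hm
  have h1 : ∀ m ∈ F, (mnorm N m : ℝ) ^ (-s) ≤ 8 * ∑ n ∈ Finset.Ico 1 K,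
      if (mnorm N m : ℝ) ≤ n then (n : ℝ) ^ (-(s + 1)) else 0 := fun m hm => by
    refine (rpow_neg_le_sum (by linarith) hs2 (mnorm_pos hN m)).trans ?_
    gcongr
    rw [← Finset.sum_filter]
    refine Finset.sum_le_sum_of_subset_of_nonneg (fun n hn => ?_) fun _ _ _ => by positivity
    have := mnorm_pos hN m
    have := hK m hm
    simp only [Finset.mem_Ico, Finset.mem_filter, Nat.cast_le] at *
    omega
  calc _ ≤ ∑ m ∈ F, 8 * ∑ n ∈ Finset.Ico 1 K,
      (if (mnorm N m : ℝ) ≤ n then (n : ℝ) ^ (-(s + 1)) else 0) := Finset.sum_le_sum h1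
    _ = 8 * ∑ n ∈ Finset.Ico 1 K, ∑ m ∈ F,
      (if (mnorm N m : ℝ) ≤ n then (n : ℝ) ^ (-(s + 1)) else 0) := by
        rw [← Finset.mul_sum, Finset.sum_comm]
    _ ≤ 8 * ∑ n ∈ Finset.Ico 1 K, C * (n : ℝ) ^ (-s) := by
        gcongr with n hn
        have hn0 : (0 : ℝ) < n := by exact_mod_cast (Finset.mem_Ico.1 hn).1
        rw [← Finset.sum_filter, Finset.sum_const, nsmul_eq_mul]
        have h2 : ((F.filter fun m => (mnorm N m : ℝ) ≤ n).card : ℝ) ≤ cnt N n := by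
          refine Nat.cast_le.2 (Finset.card_le_card fun m hm => ?_)
          exact hf.mem_elts.2 (Finset.mem_filter.1 hm).2
        calc _ ≤ C * n * (n : ℝ) ^ (-(s + 1)) := by
              gcongr; exact h2.trans (hC _ hn0.le)
          _ = _ := by
            rw [show -s = 1 + -(s + 1) by ring, Real.rpow_add hn0, Real.rpow_one]; ring
    _ = 8 * C * ∑ n ∈ Finset.Ico 1 K, (n : ℝ) ^ (-s) := by rw [← Finset.mul_sum]; ring
    _ ≤ 8 * C * (s / (s - 1)) := by gcongr; exact sum_rpow_neg_le hs K
    _ ≤ 8 * C * (2 / (s - 1)) := by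
        have : 0 < s - 1 := by linarith
        gcongr
    _ = _ := by ring

lemma summable_mnorm_rpow_neg (hN : ∀ p, 1 < N p) (hf : LocallyFinite N) {C : ℝ}
    (hC : ∀ z : ℝ, 0 ≤ z → cnt N z ≤ C * z) {s : ℝ} (hs : 1 < s) :
    Summable fun m : FreeAbMonoid P => (mnorm N m : ℝ) ^ (-s) := by
  have h : ∀ s : ℝ, 1 < s → s ≤ 2 → Summable fun m : FreeAbMonoid P => (mnorm N m : ℝ) ^ (-s) :=
    fun s hs hs2 => summable_of_sum_le (fun _ => by positivity)
      (exists_sum_rpow_neg_le hN hf hC hs hs2)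
  rcases le_or_gt s 2 with h2 | h2
  · exact h s hs h2
  · refine (h 2 one_lt_two le_rfl).of_nonneg_of_le (fun _ => by positivity) fun m => ?_
    exact Real.rpow_le_rpow_of_exponent_le (one_le_mnorm hN m) (by linarith)

lemma summable_prime_rpow_neg (hN : ∀ p, 1 < N p) (hf : LocallyFinite N) {C : ℝ}
    (hC : ∀ z : ℝ, 0 ≤ z → cnt N z ≤ C * z) {s : ℝ} (hs : 1 < s) :
    Summable fun p : P => (N p : ℝ) ^ (-s) := by
  have := (summable_mnorm_rpow_neg hN hf hC hs).comp_injective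
    (i := fun p : P => (Finsupp.single p 1 : FreeAbMonoid P))
    fun p q h => Finsupp.single_left_injective one_ne_zero h
  simpa [Function.comp_def, mnorm_single] using this

/-- The sum of `1 / N p` over the prime elements of norm at most `z`. -/
noncomputable def primeSum (N : P → ℕ) (z : ℝ) : ℝ := ∑ p ∈ primesLe N z, (N p : ℝ)⁻¹

/-- Partial summation again: 1/N(m) dominates a telescoping sum of 1/n - 1/(n + 1) over n ≥ N(m),
and the lower bound for the count turns the exchanged sum into a harmonic one. The loss of 2 comes
from n + 1 ≤ 2n. -/
lemma log_le_sum_inv (hN : ∀ p, 1 < N p) (hf : LocallyFinite N) {c : ℝ} (hc : 0 < c)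
    (hL : ∀ z : ℝ, 1 ≤ z → c * z ≤ cnt N z) {x : ℝ} (hx : 1 ≤ x) :
    c / 2 * Real.log x ≤ ∑ m ∈ elts N x, (mnorm N m : ℝ)⁻¹ := by
  set K := ⌊x⌋₊
  have h1 : ∀ m ∈ elts N x, ∑ n ∈ Finset.Ico 1 (K + 1),
      (if (mnorm N m : ℝ) ≤ n then (n : ℝ)⁻¹ - ((n + 1 : ℕ) : ℝ)⁻¹ else 0) ≤
        (mnorm N m : ℝ)⁻¹ := fun m hm => by
    have hm1 : mnorm N m ≤ K := Nat.le_floor (hf.mem_elts.1 hm)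
    rw [← Finset.sum_filter]
    have : (Finset.Ico 1 (K + 1)).filter (fun n : ℕ => (mnorm N m : ℝ) ≤ n) =
        Finset.Ico (mnorm N m) (K + 1) := by
      ext n
      have := mnorm_pos hN m
      simp only [Finset.mem_Ico, Finset.mem_filter, Nat.cast_le]
      omega
    rw [this]
    have h2 := Finset.sum_Ico_sub (fun n : ℕ => -(n : ℝ)⁻¹) (show mnorm N m ≤ K + 1 by omega)
    simp only [neg_sub_neg] at h2
    rw [h2]
    have : (0 : ℝ) ≤ ((K + 1 : ℕ) : ℝ)⁻¹ := by positivity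
    linarith
  refine le_trans ?_ (Finset.sum_le_sum h1)
  rw [Finset.sum_comm]
  have h3 : ∀ n ∈ Finset.Ico 1 (K + 1), c / 2 * (n : ℝ)⁻¹ ≤ ∑ m ∈ elts N x,
      (if (mnorm N m : ℝ) ≤ n then (n : ℝ)⁻¹ - ((n + 1 : ℕ) : ℝ)⁻¹ else 0) := fun n hn => by
    rw [Finset.mem_Ico] at hn
    have hn1 : (1 : ℝ) ≤ n := by exact_mod_cast hn.1
    have hnx : (n : ℝ) ≤ x := (Nat.le_floor_iff (by linarith)).1 (by omega)
    rw [← Finset.sum_filter, Finset.sum_const, nsmul_eq_mul]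
    have : (elts N x).filter (fun m => (mnorm N m : ℝ) ≤ n) = elts N n := by
      ext m
      simp only [Finset.mem_filter, hf.mem_elts]
      exact ⟨fun h => h.2, fun h => ⟨h.trans hnx, h⟩⟩
    rw [this, ← cnt]
    have h4 : (1 / 2 : ℝ) * (n : ℝ)⁻¹ * (n : ℝ)⁻¹ ≤ (n : ℝ)⁻¹ - ((n + 1 : ℕ) : ℝ)⁻¹ := by
      push_cast
      have : (n : ℝ)⁻¹ - ((n : ℝ) + 1)⁻¹ = (n : ℝ)⁻¹ * ((n : ℝ) + 1)⁻¹ := by field_simp; ring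
      rw [this]
      have h5 : (1 / 2 : ℝ) * (n : ℝ)⁻¹ ≤ ((n : ℝ) + 1)⁻¹ := by
        rw [one_div, ← mul_inv]
        gcongr; linarith
      have : 0 ≤ (n : ℝ)⁻¹ := by positivity
      nlinarith
    calc c / 2 * (n : ℝ)⁻¹ = c * n * ((1 / 2 : ℝ) * (n : ℝ)⁻¹ * (n : ℝ)⁻¹) := by field_simp
      _ ≤ _ := mul_le_mul (hL n hn1) h4 (by positivity) (cnt_nonneg _)
  refine le_trans ?_ (Finset.sum_le_sum h3)
  rw [← Finset.mul_sum]
  gcongr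
  have h6 := log_add_one_le_harmonic K
  rw [harmonic_eq_sum_Icc] at h6
  push_cast at h6
  calc Real.log x ≤ Real.log (K + 1) := by
        gcongr; exact (Nat.lt_floor_add_one x).le
    _ ≤ _ := h6

/-- Every element is a squarefree one times a square, so that the sum over all elements is
bounded by an Euler product. -/
lemma sum_inv_le_exp_primeSum (hN : ∀ p, 1 < N p) (hf : LocallyFinite N) (x : ℝ) :
    ∑ m ∈ elts N x, (mnorm N m : ℝ)⁻¹ ≤
      Real.exp (primeSum N x) * ∑ m ∈ elts N x, (mnorm N m : ℝ) ^ (-2 : ℝ) := by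
  classical
  -- The primes of odd exponent form the squarefree part; halving the exponents gives the square
  -- root of the remaining factor.
  let φ : FreeAbMonoid P → Finset P × FreeAbMonoid P := fun m =>
    (m.support.filter fun p => m p % 2 = 1, m.mapRange (· / 2) (by simp))
  have hφ : ∀ m, radical (φ m).1 + 2 • (φ m).2 = m := fun m => by
    ext p
    simp only [φ, Finsupp.add_apply, radical_apply, Finset.mem_filter, Finsupp.mem_support_iff,
      Finsupp.smul_apply, Finsupp.mapRange_apply, smul_eq_mul]
    split_ifs with h
    · omega
    · by_cases h0 : m p = 0
      · simp [h0]
      · have : ¬ m p % 2 = 1 := fun h1 => h ⟨h0, h1⟩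
        omega
  have hinj : Function.Injective φ := fun a b hab => by rw [← hφ a, hab, hφ b]
  let g : Finset P × FreeAbMonoid P → ℝ := fun q =>
    (∏ p ∈ q.1, (N p : ℝ)⁻¹) * (mnorm N q.2 : ℝ) ^ (-2 : ℝ)
  have hg : ∀ m, (mnorm N m : ℝ)⁻¹ = g (φ m) := fun m => by
    conv_lhs => rw [← hφ m]
    simp only [g]
    rw [mnorm_add, mnorm_radical, mnorm_nsmul, Real.rpow_neg (by positivity)]
    push_cast
    rw [mul_inv, Finset.prod_inv_distrib]
    norm_num
  calc ∑ m ∈ elts N x, (mnorm N m : ℝ)⁻¹ = ∑ q ∈ (elts N x).image φ, g q := by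
        rw [Finset.sum_image fun a _ b _ h => hinj h]
        exact Finset.sum_congr rfl fun m _ => hg m
    _ ≤ ∑ q ∈ (primesLe N x).powerset ×ˢ elts N x, g q := by
        refine Finset.sum_le_sum_of_subset_of_nonneg ?_ fun q _ _ => by
          have : 0 ≤ ∏ p ∈ q.1, (N p : ℝ)⁻¹ := Finset.prod_nonneg fun _ _ => by positivity
          positivity
        intro q hq
        obtain ⟨m, hm, rfl⟩ := Finset.mem_image.1 hq
        rw [hf.mem_elts] at hm
        have hdiv : mnorm N m = mnorm N (radical (φ m).1) * mnorm N (φ m).2 ^ 2 := by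
          rw [← mnorm_nsmul, ← mnorm_add, hφ m]
        have hr := mnorm_pos hN (radical (φ m).1)
        have hs := mnorm_pos hN (φ m).2
        rw [Finset.mem_product, Finset.mem_powerset, hf.mem_elts]
        constructor
        · intro p hp
          rw [hf.mem_primesLe]
          refine le_trans (Nat.cast_le.2 ?_) hm
          rw [hdiv, mnorm_radical]
          calc N p ≤ ∏ p ∈ (φ m).1, N p := Finset.single_le_prod' (f := N)
                (fun q _ => (hN q).le) hp
            _ ≤ _ := Nat.le_mul_of_pos_right _ (by positivity)
        · refine le_trans (Nat.cast_le.2 ?_) hm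
          rw [hdiv]
          calc mnorm N (φ m).2 ≤ mnorm N (φ m).2 ^ 2 := Nat.le_self_pow two_ne_zero _
            _ ≤ _ := Nat.le_mul_of_pos_left _ hr
    _ = (∏ p ∈ primesLe N x, (1 + (N p : ℝ)⁻¹)) * ∑ m ∈ elts N x, (mnorm N m : ℝ) ^ (-2 : ℝ) := by
        rw [Finset.sum_product, Finset.prod_one_add, Finset.sum_mul_sum]
    _ ≤ _ := by
        refine mul_le_mul_of_nonneg_right ?_ (Finset.sum_nonneg fun _ _ => by positivity)
        rw [primeSum, Real.exp_sum]
        exact Finset.prod_le_prod (fun _ _ => by positivity) fun p _ => by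
          linarith [Real.add_one_le_exp ((N p : ℝ)⁻¹)]

lemma exists_loglog_le_primeSum (hN : ∀ p, 1 < N p) (hf : LocallyFinite N) {c C : ℝ} (hc : 0 < c)
    (hL : ∀ z : ℝ, 1 ≤ z → c * z ≤ cnt N z) (hC : ∀ z : ℝ, 0 ≤ z → cnt N z ≤ C * z) :
    ∃ D : ℝ, ∀ x : ℝ, 1 < x → Real.log (Real.log x) - D ≤ primeSum N x := by
  have hC0 : 0 < C := by
    have := hL 1 le_rfl
    have := hC 1 zero_le_one
    linarith
  refine ⟨-Real.log (c / 2 / (16 * C)), fun x hx => ?_⟩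
  have h1 := (log_le_sum_inv hN hf hc hL hx.le).trans (sum_inv_le_exp_primeSum hN hf x)
  have h2 := exists_sum_rpow_neg_le hN hf hC one_lt_two le_rfl (elts N x)
  have hlog : 0 < Real.log x := Real.log_pos hx
  rw [show (2 : ℝ) - 1 = 1 by norm_num, div_one] at h2
  have h3 : c / 2 / (16 * C) * Real.log x ≤ Real.exp (primeSum N x) := by
    rw [div_mul_eq_mul_div, div_le_iff₀ (by positivity)]
    exact h1.trans (by gcongr)
  have h4 := Real.log_le_log (by positivity) h3
  rw [Real.log_exp, Real.log_mul (by positivity) hlog.ne'] at h4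
  linarith

/-- The expanded product ∏ (1 + N(p)^(-s)) is a sum over squarefree elements, hence O(1/δ) with s =
1 + δ. Taking logarithms costs only ∑ N(p)^(-2), since log(1 + t) ≥ t - t² for t ≥ 0. -/
lemma exists_sum_prime_rpow_le (hN : ∀ p, 1 < N p) (hf : LocallyFinite N) {C : ℝ} (hC0 : 0 < C)
    (hC : ∀ z : ℝ, 0 ≤ z → cnt N z ≤ C * z) :
    ∃ D : ℝ, 0 ≤ D ∧ ∀ δ : ℝ, 0 < δ → δ ≤ 1 → ∀ T : Finset P,
      ∑ p ∈ T, (N p : ℝ) ^ (-(1 + δ)) ≤ Real.log (1 / δ) + D := by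
  have hsum := summable_prime_rpow_neg hN hf hC one_lt_two
  refine ⟨|Real.log (16 * C)| + ∑' p, (N p : ℝ) ^ (-2 : ℝ), ?_, fun δ hδ hδ1 T => ?_⟩
  · have : 0 ≤ ∑' p, (N p : ℝ) ^ (-2 : ℝ) := tsum_nonneg fun p => by positivity
    positivity
  have h1 : ∏ p ∈ T, (1 + (N p : ℝ) ^ (-(1 + δ))) ≤ 16 * C / δ := by
    rw [Finset.prod_one_add]
    have h2 := exists_sum_rpow_neg_le hN hf hC (s := 1 + δ) (by linarith) (by linarith)
      (T.powerset.map ⟨radical, radical_injective⟩)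
    rw [Finset.sum_map, add_sub_cancel_left] at h2
    refine le_trans (le_of_eq ?_) h2
    refine Finset.sum_congr rfl fun S _ => ?_
    simp only [Function.Embedding.coeFn_mk, mnorm_radical]
    push_cast
    rw [Real.finsetProd_rpow _ _ fun _ _ => by positivity]
  have hpos : ∀ p, 0 < 1 + (N p : ℝ) ^ (-(1 + δ)) := fun p => by positivity
  have h3 := Real.log_le_log (Finset.prod_pos fun p _ => hpos p) h1
  rw [Real.log_prod (fun p _ => (hpos p).ne'), show 16 * C / δ = 16 * C * (1 / δ) by ring,
    Real.log_mul (by positivity) (by positivity)] at h3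
  have h4 : ∀ p ∈ T, (N p : ℝ) ^ (-(1 + δ)) ≤
      Real.log (1 + (N p : ℝ) ^ (-(1 + δ))) + (N p : ℝ) ^ (-2 : ℝ) := fun p _ => by
    have hp : (1 : ℝ) < N p := by exact_mod_cast hN p
    set t := (N p : ℝ) ^ (-(1 + δ)) with ht
    have ht0 : 0 ≤ t := by positivity
    have h5 := Real.le_log_one_add_of_nonneg ht0
    have h6 : t ^ 2 ≤ (N p : ℝ) ^ (-2 : ℝ) := by
      rw [ht, ← Real.rpow_natCast, ← Real.rpow_mul (by positivity)]
      exact Real.rpow_le_rpow_of_exponent_le hp.le (by push_cast; linarith)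
    have h7 : t - t ^ 2 ≤ 2 * t / (t + 2) := by
      rw [le_div_iff₀ (by positivity)]
      nlinarith [mul_nonneg ht0 ht0, mul_nonneg ht0 (mul_nonneg ht0 ht0)]
    linarith
  have h5 := Finset.sum_le_sum h4
  rw [Finset.sum_add_distrib] at h5
  have h6 := hsum.sum_le_tsum T fun _ _ => by positivity
  have h7 := le_abs_self (Real.log (16 * C))
  linarith

/-- Rankin's trick. Choosing δ = 1 / log x would multiply the main term by e; the smaller δ below
makes the factor exp(1/l) = 1 + O(1/l), at the price of an additional log l, harmless against √l. -/
lemma exists_primeSum_le (hN : ∀ p, 1 < N p) (hf : LocallyFinite N) {C : ℝ} (hC0 : 0 < C)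
    (hC : ∀ z : ℝ, 0 ≤ z → cnt N z ≤ C * z) :
    ∃ D : ℝ, ∀ x : ℝ, 1 < x → 1 ≤ Real.log (Real.log x) →
      primeSum N x ≤ Real.log (Real.log x) + Real.log (Real.log (Real.log x)) + D := by
  obtain ⟨D, hD0, hD⟩ := exists_sum_prime_rpow_le hN hf hC0 hC
  refine ⟨4 + 3 * D, fun x hx hl => ?_⟩
  set l := Real.log (Real.log x) with hldef
  have hL0 : 0 < Real.log x := Real.log_pos hx
  have hL1 : 1 ≤ Real.log x := by
    rw [← Real.exp_log hL0]; exact Real.one_le_exp (by linarith)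
  set δ := 1 / (Real.log x * l) with hδdef
  have hδ : 0 < δ := by positivity
  have hδ1 : δ ≤ 1 := by
    rw [hδdef, div_le_one (by positivity)]; nlinarith
  have h1 : ∀ p ∈ primesLe N x, (N p : ℝ)⁻¹ ≤ Real.exp (1 / l) * (N p : ℝ) ^ (-(1 + δ)) :=
    fun p hp => by
      rw [hf.mem_primesLe] at hp
      have hp1 : (1 : ℝ) < N p := by exact_mod_cast hN p
      have hp0 : (0 : ℝ) < N p := by linarith
      rw [← Real.rpow_neg_one, show (-1 : ℝ) = δ + -(1 + δ) by ring, Real.rpow_add hp0]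
      gcongr
      rw [Real.rpow_def_of_pos hp0, Real.exp_le_exp]
      calc Real.log (N p) * δ ≤ Real.log x * δ := by gcongr
        _ = 1 / l := by rw [hδdef]; field_simp
  have h2 := (Finset.sum_le_sum h1)
  rw [← Finset.mul_sum] at h2
  have h3 := hD δ hδ hδ1 (primesLe N x)
  have h4 : Real.log (1 / δ) = l + Real.log l := by
    rw [hδdef, one_div_one_div, Real.log_mul hL0.ne' (by positivity)]
  rw [h4] at h3
  have h5 : Real.exp (1 / l) ≤ 1 + 2 / l := by
    have hl1 : 1 / l ≤ 1 := by rw [div_le_one (by positivity)]; exact hl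
    have h0 : 0 ≤ 1 / l := by positivity
    have := Real.abs_exp_sub_one_le (x := 1 / l) (by rw [abs_of_nonneg h0]; exact hl1)
    rw [abs_of_nonneg h0] at this
    have h6 := le_abs_self (Real.exp (1 / l) - 1)
    have : 2 * (1 / l) = 2 / l := by ring
    linarith
  have hlog : Real.log l ≤ l := Real.log_le_self (by linarith)
  have hlog0 : 0 ≤ Real.log l := Real.log_nonneg hl
  have h7 : (1 + 2 / l) * (l + Real.log l + D) ≤ l + Real.log l + (4 + 3 * D) := by
    have e : (1 + 2 / l) * (l + Real.log l + D) =
        l + Real.log l + D + 2 + 2 * (Real.log l / l) + 2 * (D / l) := by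
      field_simp
      ring
    have e1 : Real.log l / l ≤ 1 := by rw [div_le_one (by positivity)]; exact hlog
    have e2 : D / l ≤ D := div_le_self hD0 hl
    linarith
  have hnn : 0 ≤ l + Real.log l + D := by linarith
  calc primeSum N x ≤ _ := h2
    _ ≤ Real.exp (1 / l) * (l + Real.log l + D) := by gcongr
    _ ≤ (1 + 2 / l) * (l + Real.log l + D) := by gcongr
    _ ≤ _ := h7

end ErdosKacMonoid

/-! ### Gaussian limit for the independent Bernoulli model -/

namespace ErdosKacMonoid

/-- With w = it/√l and v = exp(w) - 1, the logarithm of the product is v ∑ 1/N(p) + O(|v|²).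
Expanding v as w + w²/2 + O(|w|³), the term w l cancels the centring and w² l / 2 is the Gaussian
exponent. -/
lemma exists_prod_bernoulli_eq {P : Type*} {N : P → ℕ} (hN : ∀ p, 1 < N p)
    (hsum : Summable fun p : P => (N p : ℝ) ^ (-2 : ℝ)) {l t : ℝ} (h0 : 0 < l) (h1 : 1 ≤ √l)
    (h2 : 4 * |t| ≤ √l) (T : Finset P) :
    ∃ E : ℂ, Complex.exp (-(Complex.I * t * (√l : ℝ))) *
      ∏ p ∈ T, (1 + (Complex.exp (Complex.I * t / (√l : ℝ)) - 1) * ((N p : ℝ)⁻¹ : ℝ)) =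
        Complex.exp (E + -(t : ℂ) ^ 2 / 2) ∧
      ‖E‖ ≤ 4 * |t| ^ 2 * (∑' p, (N p : ℝ) ^ (-2 : ℝ)) * (√l)⁻¹ +
        2 * |t| * |(∑ p ∈ T, (N p : ℝ)⁻¹ - l) / √l| + |t| ^ 3 * (√l)⁻¹ := by
  set B := ∑' p, (N p : ℝ) ^ (-2 : ℝ)
  have hB0 : 0 ≤ B := tsum_nonneg fun p => by positivity
  set s := √(l) with hsdef
  have hs0 : 0 < s := by linarith
  have hsl : l = s ^ 2 := (Real.sq_sqrt h0.le).symm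
  set w : ℂ := Complex.I * t / (s : ℝ) with hw
  have hwn : ‖w‖ = |t| / s := by
    rw [hw, norm_div, norm_mul, Complex.norm_I, one_mul, Complex.norm_real, Complex.norm_real,
      Real.norm_eq_abs, Real.norm_of_nonneg hs0.le]
  -- This forces ‖v‖ ≤ 1/2, so every factor stays in the disc where log(1 + z) is controlled.
  have hw4 : ‖w‖ ≤ 1 / 4 := by
    rw [hwn, div_le_iff₀ hs0]; linarith
  set v : ℂ := Complex.exp w - 1 with hv
  have hvn : ‖v‖ ≤ 2 * ‖w‖ := Complex.norm_exp_sub_one_le (by linarith)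
  set S := ∑ p ∈ T, (N p : ℝ)⁻¹ with hS
  have hz : ∀ p, ‖v * ((N p : ℝ)⁻¹ : ℝ)‖ = ‖v‖ * (N p : ℝ)⁻¹ := fun p => by
    rw [norm_mul, Complex.norm_real, Real.norm_of_nonneg (by positivity)]
  have hp1 : ∀ p, (N p : ℝ)⁻¹ ≤ 1 := fun p =>
    inv_le_one_of_one_le₀ (by exact_mod_cast (hN p).le)
  have hz2 : ∀ p, ‖v * ((N p : ℝ)⁻¹ : ℝ)‖ ≤ 1 / 2 := fun p => by
    rw [hz]
    have : 0 ≤ (N p : ℝ)⁻¹ := by positivity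
    nlinarith [hp1 p, norm_nonneg v]
  have hne : ∀ p, 1 + v * ((N p : ℝ)⁻¹ : ℝ) ≠ 0 := fun p h => by
    have h3 : v * ((N p : ℝ)⁻¹ : ℝ) = -1 := by linear_combination h
    have := hz2 p
    rw [h3] at this
    norm_num at this
  set E₀ := ∑ p ∈ T, Complex.log (1 + v * ((N p : ℝ)⁻¹ : ℝ)) with hE₀
  have hprod : ∏ p ∈ T, (1 + v * ((N p : ℝ)⁻¹ : ℝ)) = Complex.exp E₀ := by
    rw [hE₀, Complex.exp_sum]
    exact Finset.prod_congr rfl fun p _ => (Complex.exp_log (hne p)).symm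
  have hE1 : ‖E₀ - v * S‖ ≤ ‖v‖ ^ 2 * B := by
    have e1 : E₀ - v * S = ∑ p ∈ T, (Complex.log (1 + v * ((N p : ℝ)⁻¹ : ℝ)) -
        v * ((N p : ℝ)⁻¹ : ℝ)) := by
      rw [Finset.sum_sub_distrib, ← Finset.mul_sum, hS, Complex.ofReal_sum]
    rw [e1]
    calc _ ≤ ∑ p ∈ T, ‖v‖ ^ 2 * (N p : ℝ) ^ (-2 : ℝ) := by
          refine norm_sum_le_of_le _ fun p _ => ?_
          refine (Complex.norm_log_one_add_sub_self_le (by linarith [hz2 p])).trans ?_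
          have e2 : (1 - ‖v * ((N p : ℝ)⁻¹ : ℝ)‖)⁻¹ ≤ 2 := by
            rw [inv_le_comm₀ (by linarith [hz2 p]) two_pos]; linarith [hz2 p]
          have e3 : ‖v * ((N p : ℝ)⁻¹ : ℝ)‖ ^ 2 = ‖v‖ ^ 2 * (N p : ℝ) ^ (-2 : ℝ) := by
            rw [hz, mul_pow, Real.rpow_neg (by positivity)]; norm_num
          rw [← e3]
          have : 0 ≤ ‖v * ((N p : ℝ)⁻¹ : ℝ)‖ ^ 2 := by positivity
          nlinarith
      _ ≤ _ := by
          rw [← Finset.mul_sum]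
          gcongr
          exact hsum.sum_le_tsum _ fun _ _ => by positivity
  have hE2 : ‖v - w - w ^ 2 / 2‖ ≤ ‖w‖ ^ 3 := by
    have := Complex.exp_bound (x := w) (by linarith) (n := 3) (by norm_num)
    simp only [Finset.sum_range_succ, Finset.sum_range_zero] at this
    norm_num [Nat.factorial] at this
    have e1 : v - w - w ^ 2 / 2 = Complex.exp w - (1 + w + w ^ 2 / 2) := by rw [hv]; ring
    rw [e1]
    have : 0 ≤ ‖w‖ ^ 3 := by positivity
    linarith
  have hws : w * (s : ℂ) ^ 2 = Complex.I * t * (s : ℝ) := by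
    have : (s : ℂ) ≠ 0 := by exact_mod_cast hs0.ne'
    rw [hw]; field_simp
  have hws2 : w ^ 2 * (s : ℂ) ^ 2 = -(t : ℂ) ^ 2 := by
    have : (s : ℂ) ≠ 0 := by exact_mod_cast hs0.ne'
    rw [hw]; field_simp; rw [Complex.I_sq]; ring
  -- The three errors: linearising the logarithms, replacing ∑ 1/N(p) by `l`, and truncating the
  -- exponential at second order.
  refine ⟨(E₀ - v * S) + v * ((S - l : ℝ) : ℂ) + (v - w - w ^ 2 / 2) * (s : ℂ) ^ 2, ?_, ?_⟩
  · rw [hprod, ← Complex.exp_add]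
    congr 1
    rw [hsl]
    push_cast
    linear_combination hws + hws2 / 2
  · refine (norm_add₃_le).trans ?_
    have hsinv : s⁻¹ ≤ 1 := inv_le_one_of_one_le₀ h1
    have hsinv0 : 0 ≤ s⁻¹ := by positivity
    have hvt : ‖v‖ ≤ 2 * |t| * s⁻¹ := by rw [hwn] at hvn; rw [mul_assoc, ← div_eq_mul_inv]; exact hvn
    gcongr
    · refine hE1.trans ?_
      calc ‖v‖ ^ 2 * B ≤ (2 * |t| * s⁻¹) ^ 2 * B := by gcongr
        _ = 4 * |t| ^ 2 * B * s⁻¹ * s⁻¹ := by ring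
        _ ≤ 4 * |t| ^ 2 * B * s⁻¹ * 1 := by gcongr
        _ = _ := mul_one _
    · rw [norm_mul, Complex.norm_real, Real.norm_eq_abs, abs_div, abs_of_pos hs0]
      calc _ ≤ 2 * |t| * s⁻¹ * |S - l| := by gcongr
        _ = _ := by field_simp
    · rw [norm_mul, norm_pow, Complex.norm_real, Real.norm_of_nonneg hs0.le]
      calc _ ≤ ‖w‖ ^ 3 * s ^ 2 := by gcongr
        _ = _ := by rw [hwn]; field_simp

/-- Asymptotics of the characteristic function of a sum of independent Bernoulli variables of
parameters `1 / N p`, normalised by `l`. -/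
lemma tendsto_prod_bernoulli {P ι : Type*} {N : P → ℕ} (hN : ∀ p, 1 < N p)
    (hsum : Summable fun p : P => (N p : ℝ) ^ (-2 : ℝ)) {F : Filter ι} {l : ι → ℝ}
    (hl : Tendsto l F atTop) {T : ι → Finset P}
    (hT : Tendsto (fun i => (∑ p ∈ T i, (N p : ℝ)⁻¹ - l i) / √(l i)) F (𝓝 0)) (t : ℝ) :
    Tendsto (fun i => Complex.exp (-(Complex.I * t * (√(l i) : ℝ))) *
      ∏ p ∈ T i, (1 + (Complex.exp (Complex.I * t / (√(l i) : ℝ)) - 1) * ((N p : ℝ)⁻¹ : ℝ)))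
      F (𝓝 (Complex.exp (-(t : ℂ) ^ 2 / 2))) := by
  have hs : Tendsto (fun i => √(l i)) F atTop := Real.tendsto_sqrt_atTop.comp hl
  rcases F.eq_or_neBot with rfl | hF
  · exact tendsto_bot
  obtain ⟨E, hE⟩ := Eventually.choice <| (hs.eventually_ge_atTop 1).mp <|
    (hs.eventually_ge_atTop (4 * |t|)).mp <| (hl.eventually_gt_atTop 0).mono fun i h0 h2 h1 =>
      exists_prod_bernoulli_eq hN hsum h0 h1 h2 (T i)
  have hE0 : Tendsto E F (𝓝 0) := by
    refine squeeze_zero_norm' (hE.mono fun i h => h.2) ?_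
    have hinv : Tendsto (fun i => (√(l i))⁻¹) F (𝓝 0) := hs.inv_tendsto_atTop
    have h := ((hinv.const_mul (4 * |t| ^ 2 * ∑' p, (N p : ℝ) ^ (-2 : ℝ))).add
      (hT.abs.const_mul (2 * |t|))).add (hinv.const_mul (|t| ^ 3))
    simp only [mul_zero, abs_zero, add_zero] at h
    exact h
  have h1 := (hE0.add_const (-(t : ℂ) ^ 2 / 2)).cexp
  rw [zero_add] at h1
  exact h1.congr' (hE.mono fun i h => h.1.symm)

end ErdosKacMonoid

/-! ### Exponential sums over the monoid and truncation of ω -/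

namespace ErdosKacMonoid

section ExponentialSums

variable {P : Type*} {N : P → ℕ}

open scoped Classical in
-- Removing one copy of each prime of `S` is a bijection.
lemma LocallyFinite.card_dvd (hf : LocallyFinite N) (hN : ∀ p, 1 < N p) (x : ℝ) (S : Finset P) :
    (((elts N x).filter fun m => S ⊆ m.support).card : ℝ) = cnt N (x / ∏ p ∈ S, (N p : ℝ)) := by
  have hpos : (0 : ℝ) < ∏ p ∈ S, (N p : ℝ) :=
    Finset.prod_pos fun p _ => by exact_mod_cast (hN p).pos
  rw [cnt, Nat.cast_inj]
  symm
  refine Finset.card_bij (fun a _ => a + radical S) (fun a ha => ?_)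
    (fun a _ b _ h => add_right_cancel h) fun m hm => ?_
  · rw [hf.mem_elts, le_div_iff₀ hpos] at ha
    rw [Finset.mem_filter, hf.mem_elts, mnorm_add, mnorm_radical]
    refine ⟨by push_cast; exact ha, fun p hp => ?_⟩
    rw [Finsupp.mem_support_iff, Finsupp.add_apply, radical_apply, if_pos hp]
    omega
  · rw [Finset.mem_filter, hf.mem_elts] at hm
    have hle : radical S ≤ m := fun p => by
      rw [radical_apply]
      split_ifs with h
      · exact Nat.one_le_iff_ne_zero.2 (Finsupp.mem_support_iff.1 (hm.2 h))
      · exact Nat.zero_le _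
    refine ⟨m - radical S, ?_, tsub_add_cancel_of_le hle⟩
    rw [hf.mem_elts, le_div_iff₀ hpos]
    have h1 := hm.1
    rw [← tsub_add_cancel_of_le hle, mnorm_add, mnorm_radical] at h1
    push_cast at h1
    exact h1

open scoped Classical in
lemma LocallyFinite.sum_prod_one_add (hf : LocallyFinite N) (hN : ∀ p, 1 < N p) (x : ℝ)
    (T : Finset P) (v : ℂ) :
    ∑ m ∈ elts N x, ∏ p ∈ T, (1 + if p ∈ m.support then v else 0) =
      ∑ S ∈ T.powerset, v ^ S.card * (cnt N (x / ∏ p ∈ S, (N p : ℝ)) : ℂ) := by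
  simp_rw [Finset.prod_one_add]
  rw [Finset.sum_comm]
  refine Finset.sum_congr rfl fun S _ => ?_
  rw [← hf.card_dvd hN, Complex.ofReal_natCast, mul_comm, ← nsmul_eq_mul, ← Finset.sum_const,
    Finset.sum_filter]
  refine Finset.sum_congr rfl fun m _ => ?_
  split_ifs with h
  · rw [← Finset.prod_const]
    exact Finset.prod_congr rfl fun p hp => if_pos (h hp)
  · obtain ⟨p, hp, hpm⟩ := Finset.not_subset.1 h
    exact Finset.prod_eq_zero hp (if_neg hpm)

open scoped Classical in
lemma norm_sum_prod_sub_le (hf : LocallyFinite N) (hN : ∀ p, 1 < N p) {X : Set ℚ}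
    (hX : IsAdmissible N X) {κ e C : ℝ}
    (hC : ∀ x ∈ X, 0 < x → |cnt N x - κ * x| ≤ C * (x : ℝ) ^ e) {x : ℚ} (hx : x ∈ X) (hx0 : 0 < x)
    (T : Finset P) (v : ℂ) :
    ‖∑ m ∈ elts N x, ∏ p ∈ T, (1 + if p ∈ m.support then v else 0) -
      (κ * x : ℝ) * ∏ p ∈ T, (1 + v * ((N p : ℝ)⁻¹ : ℝ))‖ ≤
      C * (x : ℝ) ^ e * ∏ p ∈ T, (1 + ‖v‖ * (N p : ℝ) ^ (-e)) := by
  have hxr : (0 : ℝ) < x := by exact_mod_cast hx0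
  rw [hf.sum_prod_one_add hN, Finset.prod_one_add, Finset.prod_one_add, Finset.mul_sum,
    Finset.mul_sum, ← Finset.sum_sub_distrib]
  refine norm_sum_le_of_le _ fun S _ => ?_
  have hpos : 0 < ∏ p ∈ S, N p := Finset.prod_pos fun p _ => (hN p).pos
  have hposr : (0 : ℝ) < ∏ p ∈ S, (N p : ℝ) := by exact_mod_cast hpos
  have hmem : x / (∏ p ∈ S, N p : ℕ) ∈ X := by
    rw [← mnorm_radical]
    exact hX.div_mem _ hx _ (hX.norm_mem _) (by exact_mod_cast (mnorm_pos hN _).ne')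
  have h1 := hC _ hmem (div_pos hx0 (by exact_mod_cast hpos))
  push_cast at h1
  rw [Finset.prod_mul_distrib, Finset.prod_mul_distrib, Finset.prod_const, Finset.prod_const,
    Real.finsetProd_rpow _ _ fun _ _ => by positivity, ← Complex.ofReal_prod,
    Finset.prod_inv_distrib]
  have h2 : v ^ S.card * (cnt N (x / ∏ p ∈ S, (N p : ℝ)) : ℂ) -
      (κ * x : ℝ) * (v ^ S.card * ((∏ p ∈ S, (N p : ℝ))⁻¹ : ℝ)) =
      v ^ S.card * ((cnt N (x / ∏ p ∈ S, (N p : ℝ)) - κ * (x / ∏ p ∈ S, (N p : ℝ)) : ℝ) : ℂ) := by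
    push_cast
    ring
  rw [h2, norm_mul, norm_pow, Complex.norm_real, Real.norm_eq_abs]
  calc _ ≤ ‖v‖ ^ S.card * (C * (x / ∏ p ∈ S, (N p : ℝ)) ^ e) := by gcongr
    _ = _ := by
      rw [Real.div_rpow hxr.le hposr.le, Real.rpow_neg hposr.le]
      ring

open scoped Classical in
/-- The number of prime elements outside `T` is small on average. -/
lemma sum_omega_sub_le (hf : LocallyFinite N) (hN : ∀ p, 1 < N p) {C : ℝ}
    (hC : ∀ z : ℝ, 0 ≤ z → cnt N z ≤ C * z) {x y : ℝ} (hx : 0 ≤ x) (hxy : y ≤ x) :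
    ∑ m ∈ elts N x, ((omega m : ℝ) -
      ((primesLe N y).filter fun p => p ∈ m.support).card) ≤
      C * x * (primeSum N x - primeSum N y) := by
  have hsub : primesLe N y ⊆ primesLe N x := fun p hp => by
    rw [hf.mem_primesLe] at *; exact hp.trans hxy
  have h1 : ∀ m ∈ elts N x, ((omega m : ℝ) - ((primesLe N y).filter fun p => p ∈ m.support).card) =
      ∑ p ∈ primesLe N x \ primesLe N y, if {p} ⊆ m.support then (1 : ℝ) else 0 := fun m hm => by
    have hm' : m.support = (primesLe N x).filter fun p => p ∈ m.support := by
      ext p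
      rw [Finset.mem_filter, hf.mem_primesLe]
      refine ⟨fun hp => ⟨?_, hp⟩, fun h => h.2⟩
      rw [hf.mem_elts] at hm
      refine le_trans (Nat.cast_le.2 ?_) hm
      rw [mnorm, Finsupp.prod]
      calc N p ≤ N p ^ m p := Nat.le_self_pow (Finsupp.mem_support_iff.1 hp) _
        _ ≤ _ := Finset.single_le_prod' (f := fun p => N p ^ m p)
          (fun q _ => Nat.one_le_pow _ _ (hN q).pos) hp
    rw [omega]
    conv_lhs => rw [hm']
    simp only [Finset.singleton_subset_iff, Finset.mem_filter]
    rw [← Finset.sum_filter, Finset.sum_const, nsmul_one]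
    have h2 := Finset.card_sdiff_add_card_eq_card
      (Finset.filter_subset_filter (fun p => p ∈ m.support) hsub)
    have h3 : (primesLe N x \ primesLe N y).filter (fun p => p ∈ m.support) =
        (primesLe N x).filter (fun p => p ∈ m.support) \
          (primesLe N y).filter (fun p => p ∈ m.support) := by
      ext p
      simp only [Finset.mem_filter, Finset.mem_sdiff]
      tauto
    rw [h3]
    have h4 : (primesLe N y).filter (fun p => p ∈ primesLe N x ∧ p ∈ m.support) =
        (primesLe N y).filter (fun p => p ∈ m.support) :=
      Finset.filter_congr fun p hp => ⟨fun h => h.2, fun h => ⟨hsub hp, h⟩⟩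
    have h5 : (((primesLe N x).filter (fun p => p ∈ m.support) \
          (primesLe N y).filter (fun p => p ∈ m.support)).card : ℝ) +
        ((primesLe N y).filter (fun p => p ∈ m.support)).card =
        ((primesLe N x).filter (fun p => p ∈ m.support)).card := by exact_mod_cast h2
    rw [h4]
    linarith
  rw [Finset.sum_congr rfl h1, Finset.sum_comm, primeSum, primeSum]
  rw [← Finset.sum_sdiff hsub, add_sub_cancel_right, Finset.mul_sum]
  refine Finset.sum_le_sum fun p _ => ?_
  rw [← Finset.sum_filter, Finset.sum_const, nsmul_one, hf.card_dvd hN, Finset.prod_singleton]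
  refine (hC _ (by positivity)).trans (le_of_eq (by ring))

end ExponentialSums

section CharFun

variable {P : Type*} {N : P → ℕ} {X : Set ℚ} {κ θ : ℝ}

lemma tendsto_log_div_sqrt : Tendsto (fun x : ℝ => Real.log x / √x) atTop (𝓝 0) := by
  simpa [Real.sqrt_eq_rpow] using
    (isLittleO_log_rpow_atTop (by norm_num : (0 : ℝ) < 1 / 2)).tendsto_div_nhds_zero

lemma tendsto_loglog_toInfinity :
    Tendsto (fun x : ℚ => Real.log (Real.log x)) (toInfinity X) atTop :=
  Real.tendsto_log_atTop.comp (Real.tendsto_log_atTop.comp tendsto_toInfinity_cast)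

/-- The truncation level for the prime elements: `log (truncation x) = log x / log log x`. -/
noncomputable def truncation (x : ℝ) : ℝ := Real.exp (Real.log x / Real.log (Real.log x))

lemma truncation_le {x : ℝ} (hx : 1 < x) (hl : 1 ≤ Real.log (Real.log x)) : truncation x ≤ x := by
  have hL : 0 < Real.log x := Real.log_pos hx
  rw [truncation, ← Real.le_log_iff_exp_le (by linarith)]
  exact div_le_self hL.le hl

/-- The double logarithm of the truncation level is l - log l, so the weak Mertens bounds at `x` and
at the level differ by O(log l) only. -/
lemma exists_primeSum_truncation (hN : ∀ p, 1 < N p) (hX : IsAdmissible N X)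
    (hstar : Star N X κ θ) (p₀ : P) : ∃ D : ℝ, 0 ≤ D ∧ ∀ x : ℝ, 1 < x →
      1 ≤ Real.log (Real.log x) →
      |primeSum N (truncation x) - Real.log (Real.log x)| ≤
          Real.log (Real.log (Real.log x)) + D ∧
        primeSum N x - primeSum N (truncation x) ≤ 2 * Real.log (Real.log (Real.log x)) + D := by
  have hf := hstar.locallyFinite hN hX p₀
  obtain ⟨C, hC0, hC⟩ := hstar.cnt_le hN hX p₀
  obtain ⟨c, hc0, hc⟩ := hstar.le_cnt hN hX p₀
  obtain ⟨D₁, hD₁⟩ := exists_loglog_le_primeSum hN hf hc0 hc hC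
  obtain ⟨D₂, hD₂⟩ := exists_primeSum_le hN hf hC0 hC
  refine ⟨|D₁| + |D₂|, by positivity, fun x hx hl => ?_⟩
  have hL : 0 < Real.log x := Real.log_pos hx
  have hl0 : 0 < Real.log (Real.log x) := by linarith
  have h1 := hD₂ x hx hl
  have hy1 : 1 < truncation x := Real.one_lt_exp_iff.2 (by positivity)
  have h2 := hD₁ _ hy1
  rw [truncation, Real.log_exp, Real.log_div hL.ne' hl0.ne', ← truncation] at h2
  have h3 : primeSum N (truncation x) ≤ primeSum N x := by
    refine Finset.sum_le_sum_of_subset_of_nonneg (fun p hp => ?_) fun _ _ _ => by positivity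
    rw [hf.mem_primesLe] at *
    exact hp.trans (truncation_le hx hl)
  have := le_abs_self D₁
  have := le_abs_self D₂
  have := abs_nonneg D₁
  have := abs_nonneg D₂
  exact ⟨abs_le.2 ⟨by linarith, by linarith⟩, by linarith⟩

end CharFun

end ErdosKacMonoid

/-! ### Convergence of the characteristic functions of ω -/

namespace ErdosKacMonoid

variable {P : Type*} {N : P → ℕ} {X : Set ℚ} {κ θ : ℝ}

open scoped Classical in
lemma exp_mul_prod_eq (T : Finset P) (m : FreeAbMonoid P) {l : ℝ} (hl : 0 < l) (t : ℝ) :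
    Complex.exp (-(Complex.I * t * (√l : ℝ))) * ∏ p ∈ T,
      (1 + if p ∈ m.support then Complex.exp (Complex.I * t / (√l : ℝ)) - 1 else 0) =
    Complex.exp (Complex.I * ((t * (((T.filter fun p => p ∈ m.support).card - l) / √l) : ℝ) : ℂ)) := by
  have h1 : ∀ p ∈ T, (1 + if p ∈ m.support then Complex.exp (Complex.I * t / (√l : ℝ)) - 1 else 0) =
      if p ∈ m.support then Complex.exp (Complex.I * t / (√l : ℝ)) else 1 := fun p _ => by
    split_ifs <;> ring
  rw [Finset.prod_congr rfl h1, ← Finset.prod_filter, Finset.prod_const, ← Complex.exp_nat_mul,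
    ← Complex.exp_add]
  congr 1
  have hs : ((√l : ℝ) : ℂ) ≠ 0 := by exact_mod_cast (Real.sqrt_pos.2 hl).ne'
  have hs2 : (l : ℂ) = ((√l : ℝ) : ℂ) ^ 2 := by exact_mod_cast (Real.sq_sqrt hl.le).symm
  push_cast
  rw [hs2]
  field_simp
  ring

lemma norm_exp_I_sub_exp_I_le (a b : ℝ) :
    ‖Complex.exp (Complex.I * a) - Complex.exp (Complex.I * b)‖ ≤ |a - b| := by
  have h1 : Complex.exp (Complex.I * a) - Complex.exp (Complex.I * b) =
      Complex.exp (b * Complex.I) * (Complex.exp (Complex.I * ((a - b : ℝ) : ℂ)) - 1) := by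
    rw [mul_sub, ← Complex.exp_add, mul_one, mul_comm (b : ℂ)]
    congr 2
    push_cast
    ring
  rw [h1, norm_mul, Complex.norm_exp_ofReal_mul_I, one_mul]
  exact Real.norm_exp_I_mul_ofReal_sub_one_le

lemma tendsto_primeSum_truncation (hN : ∀ p, 1 < N p) (hX : IsAdmissible N X)
    (hstar : Star N X κ θ) (p₀ : P) :
    Tendsto (fun x : ℚ => (primeSum N (truncation x) - Real.log (Real.log x)) /
      √(Real.log (Real.log x))) (toInfinity X) (𝓝 0) := by
  obtain ⟨D, hD0, hD⟩ := exists_primeSum_truncation hN hX hstar p₀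
  have hl := tendsto_loglog_toInfinity (X := X)
  have h1 : Tendsto (fun x : ℚ => Real.log (Real.log (Real.log x)) / √(Real.log (Real.log x)) +
      D * (√(Real.log (Real.log x)))⁻¹) (toInfinity X) (𝓝 0) := by
    have := (tendsto_log_div_sqrt.comp hl).add
      (((Real.tendsto_sqrt_atTop.comp hl).inv_tendsto_atTop).const_mul D)
    rw [mul_zero, add_zero] at this
    exact this
  refine squeeze_zero_norm' ?_ h1
  filter_upwards [tendsto_toInfinity_cast.eventually_gt_atTop 1, hl.eventually_ge_atTop 1]
    with x hx hlx
  rw [norm_div, Real.norm_eq_abs, Real.norm_of_nonneg (Real.sqrt_nonneg _), ← div_eq_mul_inv,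
    ← add_div]
  gcongr
  exact (hD x hx hlx).1

lemma tendsto_prod_truncation (hN : ∀ p, 1 < N p) (hX : IsAdmissible N X)
    (hstar : Star N X κ θ) (p₀ : P) (t : ℝ) :
    Tendsto (fun x : ℚ => Complex.exp (-(Complex.I * t * (√(Real.log (Real.log x)) : ℝ))) *
      ∏ p ∈ primesLe N (truncation x), (1 + (Complex.exp (Complex.I * t /
        (√(Real.log (Real.log x)) : ℝ)) - 1) * ((N p : ℝ)⁻¹ : ℝ)))
      (toInfinity X) (𝓝 (Complex.exp (-(t : ℂ) ^ 2 / 2))) := by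
  have hf := hstar.locallyFinite hN hX p₀
  obtain ⟨C, hC0, hC⟩ := hstar.cnt_le hN hX p₀
  exact tendsto_prod_bernoulli hN (summable_prime_rpow_neg hN hf hC one_lt_two)
    tendsto_loglog_toInfinity (tendsto_primeSum_truncation hN hX hstar p₀) t

lemma tendsto_exp_neg_add_sqrt (a : ℝ) :
    Tendsto (fun l : ℝ => Real.exp (-l + a * √l)) atTop (𝓝 0) := by
  refine Real.tendsto_exp_atBot.comp ?_
  have h1 : Tendsto (fun l : ℝ => √l * (a - √l)) atTop atBot :=
    Real.tendsto_sqrt_atTop.atTop_mul_atBot₀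
      (tendsto_atBot_add_const_left _ a (tendsto_neg_atTop_atBot.comp Real.tendsto_sqrt_atTop))
  refine h1.congr' ?_
  filter_upwards [eventually_ge_atTop 0] with l hl
  nlinarith [Real.sq_sqrt hl]

open scoped Classical in
-- With δ = l / log x one has x^(1 - δ) = x / log x, while N(p)^δ ≤ e below the truncation level.
-- The relative error is thus O(exp(-l + 12|t|√l)).
lemma tendsto_truncation_error (hN : ∀ p, 1 < N p) (hX : IsAdmissible N X)
    (hstar : Star N X κ θ) (p₀ : P) (t : ℝ) :
    Tendsto (fun x : ℚ => ‖∑ m ∈ elts N x, ∏ p ∈ primesLe N (truncation x),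
        (1 + if p ∈ m.support then
          Complex.exp (Complex.I * t / (√(Real.log (Real.log x)) : ℝ)) - 1 else 0) -
      (κ * x : ℝ) * ∏ p ∈ primesLe N (truncation x), (1 + (Complex.exp (Complex.I * t /
        (√(Real.log (Real.log x)) : ℝ)) - 1) * ((N p : ℝ)⁻¹ : ℝ))‖ / cnt N x)
      (toInfinity X) (𝓝 0) := by
  have hf := hstar.locallyFinite hN hX p₀
  obtain ⟨C, hC0, hC⟩ := hstar.abs_cnt_sub_le hN hf
  obtain ⟨c, hc0, hc⟩ := hstar.le_cnt hN hX p₀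
  have hl := tendsto_loglog_toInfinity (X := X)
  have hT := tendsto_primeSum_truncation hN hX hstar p₀
  have h1 := ((tendsto_exp_neg_add_sqrt (12 * |t|)).comp hl).const_mul (C / c)
  rw [mul_zero] at h1
  have h2 : Tendsto (fun x : ℚ => Real.log (Real.log x) / Real.log x) (toInfinity X) (𝓝 0) := by
    have := (Real.isLittleO_log_id_atTop.tendsto_div_nhds_zero).comp
      (Real.tendsto_log_atTop.comp (tendsto_toInfinity_cast (X := X)))
    exact this
  refine squeeze_zero' (Eventually.of_forall fun x => div_nonneg (norm_nonneg _) (cnt_nonneg _)) ?_ h1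
  filter_upwards [tendsto_toInfinity_cast.eventually_gt_atTop 1, hl.eventually_ge_atTop 1,
    eventually_mem_toInfinity, h2.eventually_le_const (sub_pos.2 hstar.theta_lt_one),
    hT.eventually_le_const one_pos,
    (Real.tendsto_sqrt_atTop.comp hl).eventually_ge_atTop |t|] with x hx hlx hxX hδ hS hst
  simp only [Function.comp_apply] at hst ⊢
  set L := Real.log (x : ℝ) with hLdef
  set l := Real.log L with hldef
  have hL : 0 < L := Real.log_pos hx
  have hl0 : 0 < l := by linarith
  set s := √l with hsdef
  have hs1 : 1 ≤ s := Real.one_le_sqrt.2 hlx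
  have hs0 : 0 < s := by linarith
  have hss : s ^ 2 = l := Real.sq_sqrt hl0.le
  set δ := l / L with hδdef
  have hδ0 : 0 < δ := by positivity
  set v := Complex.exp (Complex.I * t / (s : ℝ)) - 1 with hv
  have hx0 : (0 : ℝ) < x := by linarith
  have hvn : ‖v‖ ≤ 2 * (|t| / s) := by
    have e1 : ‖Complex.I * t / ((s : ℝ) : ℂ)‖ = |t| / s := by
      rw [norm_div, norm_mul, Complex.norm_I, one_mul, Complex.norm_real, Complex.norm_real,
        Real.norm_eq_abs, Real.norm_of_nonneg hs0.le]
    rw [← e1]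
    refine Complex.norm_exp_sub_one_le ?_
    rw [e1, div_le_one hs0]
    exact hst
  -- The exponent varies with `x`; it eventually exceeds θ since δ tends to 0, and the constant `C`
  -- is uniform in the exponent.
  have h3 := norm_sum_prod_sub_le hf hN hX (κ := κ) (e := 1 - δ) (C := C)
    (fun y hy hy0 => hC y hy hy0 _ (by linarith) (by linarith)) hxX (by exact_mod_cast hx0)
    (primesLe N (truncation x)) v
  have h4 : ∏ p ∈ primesLe N (truncation x), (1 + ‖v‖ * (N p : ℝ) ^ (-(1 - δ))) ≤
      Real.exp (12 * |t| * s) := by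
    calc _ ≤ ∏ p ∈ primesLe N (truncation x), Real.exp (‖v‖ * (3 * (N p : ℝ)⁻¹)) := by
          refine Finset.prod_le_prod (fun _ _ => by positivity) fun p hp => ?_
          rw [hf.mem_primesLe] at hp
          have hp0 : (0 : ℝ) < N p := by exact_mod_cast (hN p).pos
          have e1 : (N p : ℝ) ^ (-(1 - δ)) ≤ 3 * (N p : ℝ)⁻¹ := by
            rw [show -(1 - δ) = δ + -1 by ring, Real.rpow_add hp0, Real.rpow_neg_one]
            gcongr
            calc (N p : ℝ) ^ δ ≤ truncation x ^ δ := by gcongr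
              _ = Real.exp 1 := by
                rw [truncation, ← Real.exp_mul, ← hLdef, ← hldef, hδdef]
                congr 1
                field_simp
              _ ≤ 3 := by linarith [Real.exp_one_lt_d9]
          have e2 : ‖v‖ * (N p : ℝ) ^ (-(1 - δ)) ≤ ‖v‖ * (3 * (N p : ℝ)⁻¹) := by gcongr
          linarith [Real.add_one_le_exp (‖v‖ * (3 * (N p : ℝ)⁻¹))]
      _ = Real.exp (3 * ‖v‖ * primeSum N (truncation x)) := by
          rw [← Real.exp_sum, primeSum, ← Finset.mul_sum, ← Finset.mul_sum]
          congr 1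
          ring
      _ ≤ _ := by
          rw [Real.exp_le_exp]
          -- Eventually the prime sum is at most l + √l, and l = s² with s ≥ 1.
          have e3 : primeSum N (truncation x) ≤ 2 * s ^ 2 := by
            rw [div_le_one hs0] at hS
            nlinarith
          have e4 : 0 ≤ primeSum N (truncation x) := Finset.sum_nonneg fun _ _ => by positivity
          calc 3 * ‖v‖ * primeSum N (truncation x) ≤ 3 * (2 * (|t| / s)) * (2 * s ^ 2) := by gcongr
            _ = 12 * |t| * s := by field_simp; ring
  have h5 : (x : ℝ) ^ (1 - δ) = x * Real.exp (-l) := by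
    rw [Real.rpow_sub hx0, Real.rpow_one, Real.rpow_def_of_pos hx0, Real.exp_neg, div_eq_mul_inv,
      ← hLdef, hδdef, mul_div_cancel₀ _ hL.ne']
  rw [div_le_iff₀ (by have := hc x hx.le; nlinarith)]
  calc _ ≤ _ := h3
    _ ≤ C * (x * Real.exp (-l)) * Real.exp (12 * |t| * s) := by rw [h5]; gcongr
    _ = C / c * Real.exp (-l + 12 * |t| * s) * (c * x) := by
        rw [Real.exp_add]; field_simp
    _ ≤ _ := by gcongr; exact hc x hx.le

lemma tendsto_charFun_omega (hN : ∀ p, 1 < N p) (hX : IsAdmissible N X)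
    (hstar : Star N X κ θ) (p₀ : P) (t : ℝ) :
    Tendsto (fun x : ℚ => (∑ m ∈ elts N x, Complex.exp (Complex.I *
      ((t * ((omega m - Real.log (Real.log x)) / √(Real.log (Real.log x))) : ℝ) : ℂ))) / cnt N x)
      (toInfinity X) (𝓝 (Complex.exp (-(t : ℂ) ^ 2 / 2))) := by
  classical
  have hf := hstar.locallyFinite hN hX p₀
  obtain ⟨C, hC0, hC⟩ := hstar.cnt_le hN hX p₀
  obtain ⟨c, hc0, hc⟩ := hstar.le_cnt hN hX p₀
  obtain ⟨D, hD0, hD⟩ := exists_primeSum_truncation hN hX hstar p₀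
  have hl := tendsto_loglog_toInfinity (X := X)
  have hκ := hstar.kappa_pos
  let e : ℚ → ℂ := fun x => Complex.exp (-(Complex.I * t * (√(Real.log (Real.log x)) : ℝ)))
  let M : ℚ → ℂ := fun x => ∏ p ∈ primesLe N (truncation x), (1 + (Complex.exp (Complex.I * t /
        (√(Real.log (Real.log x)) : ℝ)) - 1) * ((N p : ℝ)⁻¹ : ℝ))
  let S : ℚ → ℂ := fun x => ∑ m ∈ elts N x, ∏ p ∈ primesLe N (truncation x),
        (1 + if p ∈ m.support then
          Complex.exp (Complex.I * t / (√(Real.log (Real.log x)) : ℝ)) - 1 else 0)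
  let G : ℚ → ℂ := fun x => ∑ m ∈ elts N x, Complex.exp (Complex.I *
      ((t * ((omega m - Real.log (Real.log x)) / √(Real.log (Real.log x))) : ℝ) : ℂ))
  have hen : ∀ x, ‖e x‖ = 1 := fun x => by
    have : -(Complex.I * t * (√(Real.log (Real.log x)) : ℝ)) =
        ((-(t * √(Real.log (Real.log x))) : ℝ) : ℂ) * Complex.I := by push_cast; ring
    simp only [e]
    rw [this, Complex.norm_exp_ofReal_mul_I]
  have h1 : Tendsto (fun x => e x * M x) (toInfinity X) (𝓝 (Complex.exp (-(t : ℂ) ^ 2 / 2))) :=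
    tendsto_prod_truncation hN hX hstar p₀ t
  have h2 : Tendsto (fun x : ℚ => ((κ * (cnt N x / x)⁻¹ : ℝ) : ℂ)) (toInfinity X) (𝓝 1) := by
    have := ((hstar.tendsto_cnt_div hf).inv₀ hκ.ne').const_mul κ
    rw [mul_inv_cancel₀ hκ.ne'] at this
    exact_mod_cast (Complex.continuous_ofReal.tendsto 1).comp this
  have h3 : Tendsto (fun x : ℚ => e x * ((S x - (κ * x : ℝ) * M x) / cnt N x)) (toInfinity X)
      (𝓝 0) := by
    refine squeeze_zero_norm (fun x => ?_) (tendsto_truncation_error hN hX hstar p₀ t)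
    rw [norm_mul, hen, one_mul, norm_div, Complex.norm_real, Real.norm_of_nonneg (cnt_nonneg _)]
  have h4 : Tendsto (fun x : ℚ => (G x - e x * S x) / cnt N x) (toInfinity X) (𝓝 0) := by
    have hlim : Tendsto (fun x : ℚ => |t| * (C / c) * (2 * (Real.log (Real.log (Real.log x)) /
        √(Real.log (Real.log x))) + D * (√(Real.log (Real.log x)))⁻¹)) (toInfinity X) (𝓝 0) := by
      have := (((tendsto_log_div_sqrt.comp hl).const_mul 2).add
        (((Real.tendsto_sqrt_atTop.comp hl).inv_tendsto_atTop).const_mul D)).const_mul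
          (|t| * (C / c))
      rw [mul_zero, mul_zero, add_zero, mul_zero] at this
      exact this
    refine squeeze_zero_norm' ?_ hlim
    filter_upwards [tendsto_toInfinity_cast.eventually_gt_atTop 1, hl.eventually_ge_atTop 1]
      with x hx hlx
    have hs0 : 0 < √(Real.log (Real.log x)) := Real.sqrt_pos.2 (by linarith)
    have hx0 : (0 : ℝ) < x := by linarith
    have hcx := hc x hx.le
    have hb : ‖G x - e x * S x‖ ≤ |t| / √(Real.log (Real.log x)) *
        (C * x * (2 * Real.log (Real.log (Real.log x)) + D)) := by
      simp only [G, S, Finset.mul_sum, e]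
      rw [← Finset.sum_sub_distrib]
      calc _ ≤ ∑ m ∈ elts N x, |t| / √(Real.log (Real.log x)) * ((omega m : ℝ) -
            ((primesLe N (truncation x)).filter fun p => p ∈ m.support).card) := by
            refine norm_sum_le_of_le _ fun m _ => ?_
            rw [exp_mul_prod_eq _ _ (by linarith)]
            refine (norm_exp_I_sub_exp_I_le _ _).trans (le_of_eq ?_)
            have hle : (((primesLe N (truncation x)).filter fun p => p ∈ m.support).card : ℝ) ≤
                omega m := Nat.cast_le.2 (Finset.card_le_card fun p hp => (Finset.mem_filter.1 hp).2)
            rw [← mul_sub, ← sub_div, abs_mul, abs_div, abs_of_pos hs0, sub_sub_sub_cancel_right,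
              abs_of_nonneg (sub_nonneg.2 hle)]
            ring
        _ ≤ _ := by
            rw [← Finset.mul_sum]
            gcongr
            refine (sum_omega_sub_le hf hN hC hx0.le (truncation_le hx hlx)).trans ?_
            gcongr
            exact (hD x hx hlx).2
    have hnn : 0 ≤ 2 * Real.log (Real.log (Real.log x)) + D := by
      have := Real.log_nonneg hlx
      positivity
    rw [norm_div, Complex.norm_real, Real.norm_of_nonneg (cnt_nonneg _),
      div_le_iff₀ (by nlinarith)]
    calc _ ≤ _ := hb
      _ = |t| * (C / c) * (2 * (Real.log (Real.log (Real.log x)) /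
        √(Real.log (Real.log x))) + D * (√(Real.log (Real.log x)))⁻¹) * (c * x) := by
          field_simp
      _ ≤ _ := by
          refine mul_le_mul_of_nonneg_left hcx ?_
          have := Real.log_nonneg hlx
          positivity
  -- G/cnt = (κx/cnt) e M + e (S - κxM)/cnt + (G - eS)/cnt: model, counting error, omitted primes.
  have h5 := ((h2.mul h1).add h3).add h4
  rw [one_mul, add_zero, add_zero] at h5
  refine h5.congr' ?_
  filter_upwards [tendsto_toInfinity_cast.eventually_gt_atTop 1] with x hx
  have hcx := hc x hx.le
  have hc1 : (cnt N x : ℂ) ≠ 0 := by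
    have : cnt N x ≠ 0 := by nlinarith
    exact_mod_cast this
  have hx0 : (x : ℂ) ≠ 0 := by
    have : (x : ℝ) ≠ 0 := by linarith
    exact_mod_cast this
  simp only [G]
  push_cast
  field_simp
  ring

end ErdosKacMonoid

/-! ### From characteristic functions to distribution functions -/

namespace ErdosKacMonoid

section Empirical

open MeasureTheory ProbabilityTheory

/-- The distribution of `g` on a finite set with uniform weights. -/
noncomputable def empirical {α : Type*} (E : Finset α) (g : α → ℝ) : Measure ℝ :=
  (E.card : ENNReal)⁻¹ • ∑ m ∈ E, Measure.dirac (g m)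

lemma isProbabilityMeasure_empirical {α : Type*} {E : Finset α} (hE : E.Nonempty) (g : α → ℝ) :
    IsProbabilityMeasure (empirical E g) := ⟨by
  have h : (E.card : ENNReal) ≠ 0 := by exact_mod_cast hE.card_pos.ne'
  simp [empirical, ENNReal.inv_mul_cancel h (ENNReal.natCast_ne_top _)]⟩

lemma charFun_empirical {α : Type*} (E : Finset α) (g : α → ℝ) (t : ℝ) :
    charFun (empirical E g) t =
      (∑ m ∈ E, Complex.exp (Complex.I * ((t * g m : ℝ) : ℂ))) / (E.card : ℝ) := by
  rw [charFun_apply_real, empirical, integral_smul_measure, integral_finsetSum_measure]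
  · simp only [integral_dirac, ENNReal.toReal_inv, ENNReal.toReal_natCast]
    rw [Complex.real_smul, div_eq_mul_inv, mul_comm]
    push_cast
    congr 1
    exact Finset.sum_congr rfl fun m _ => by rw [mul_comm Complex.I]
  · intro m _
    exact integrable_dirac (by simp)

lemma empirical_Iic {α : Type*} (E : Finset α) (g : α → ℝ) (a : ℝ) :
    (empirical E g (Set.Iic a)).toReal = ((E.filter fun m => g m ≤ a).card : ℝ) / E.card := by
  classical
  rw [empirical, Measure.smul_apply, Measure.finsetSum_apply]
  simp only [Measure.dirac_apply' _ measurableSet_Iic, smul_eq_mul, ENNReal.toReal_mul,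
    ENNReal.toReal_inv, ENNReal.toReal_natCast]
  rw [div_eq_inv_mul]
  congr 1
  simp only [Set.indicator_apply, Set.mem_Iic, Pi.one_apply]
  rw [← Finset.sum_filter]
  simp

lemma gaussianCDF_eq (a : ℝ) : gaussianCDF a = (gaussianReal 0 1 (Set.Iic a)).toReal := by
  rw [gaussianReal_apply_eq_integral 0 one_ne_zero, ENNReal.toReal_ofReal, gaussianCDF,
    ← integral_const_mul]
  · simp [gaussianPDFReal, neg_div]
  · exact setIntegral_nonneg measurableSet_Iic fun x _ => gaussianPDFReal_nonneg _ _ _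

lemma gaussianReal_singleton (x : ℝ) : gaussianReal 0 1 {x} = 0 :=
  gaussianReal_absolutelyContinuous 0 one_ne_zero (by simp)

lemma continuous_gaussianCDF : Continuous gaussianCDF := by
  have hint : Integrable fun u : ℝ => Real.exp (-u ^ 2 / 2) := by
    have := integrable_exp_neg_mul_sq (b := 1 / 2) (by norm_num)
    refine this.congr (Eventually.of_forall fun u => ?_)
    ring_nf
  refine continuous_const.mul (continuous_iff_continuousAt.2 fun a => ?_)
  exact (IntegrableOn.continuousOn_Iic_primitive_Iic (a₀ := a + 1) hint.integrableOn).continuousAt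
    (Iic_mem_nhds (lt_add_one a))

/-- Lévy's theorem for empirical distributions with Gaussian limit. -/
lemma tendsto_card_filter_le {α ι : Type*} {F : Filter ι} [F.IsCountablyGenerated]
    {E : ι → Finset α} (hE : ∀ i, (E i).Nonempty) {g : ι → α → ℝ}
    (h : ∀ t : ℝ, Tendsto (fun i => (∑ m ∈ E i, Complex.exp (Complex.I * ((t * g i m : ℝ) : ℂ))) /
      ((E i).card : ℝ)) F (𝓝 (Complex.exp (-(t : ℂ) ^ 2 / 2)))) (a : ℝ) :
    Tendsto (fun i => (((E i).filter fun m => g i m ≤ a).card : ℝ) / (E i).card) F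
      (𝓝 (gaussianCDF a)) := by
  -- Lévy's theorem is applied along sequences, which suffices for a countably generated filter.
  refine tendsto_of_seq_tendsto fun u hu => ?_
  let μ : ℕ → ProbabilityMeasure ℝ := fun n =>
    ⟨empirical (E (u n)) (g (u n)), isProbabilityMeasure_empirical (hE _) _⟩
  let μ₀ : ProbabilityMeasure ℝ := ⟨gaussianReal 0 1, inferInstance⟩
  have hlim : Tendsto μ atTop (𝓝 μ₀) := by
    refine ProbabilityMeasure.tendsto_of_tendsto_charFun fun t => ?_
    simp only [μ, μ₀, ProbabilityMeasure.coe_mk, charFun_empirical, charFun_gaussianReal]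
    have e : Complex.exp (t * (0 : ℝ) * Complex.I - ((1 : NNReal) : ℝ) * (t : ℂ) ^ 2 / 2) =
        Complex.exp (-(t : ℂ) ^ 2 / 2) := by
      congr 1
      push_cast
      ring
    rw [e]
    exact (h t).comp hu
  have h2 := ProbabilityMeasure.tendsto_measure_of_null_frontier_of_tendsto' hlim
    (E := Set.Iic a) (by
      rw [frontier_Iic]
      exact gaussianReal_singleton a)
  have h3 := (ENNReal.tendsto_toReal (measure_ne_top _ _)).comp h2
  rw [gaussianCDF_eq]
  refine h3.congr fun n => ?_
  exact empirical_Iic _ _ _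

end Empirical

variable {P : Type*} {N : P → ℕ} {X : Set ℚ} {κ θ : ℝ}

instance : (toInfinity X).IsCountablyGenerated := by unfold toInfinity; infer_instance

/-- The Erdős–Kac theorem for the elements of the monoid. -/
lemma tendsto_card_omega_le (hN : ∀ p, 1 < N p) (hX : IsAdmissible N X)
    (hstar : Star N X κ θ) (p₀ : P) (a : ℝ) :
    Tendsto (fun x : ℚ => (((elts N x).filter fun m =>
      ((omega m : ℝ) - Real.log (Real.log x)) / √(Real.log (Real.log x)) ≤ a).card : ℝ) / cnt N x)
      (toInfinity X) (𝓝 (gaussianCDF a)) := by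
  have hf := hstar.locallyFinite hN hX p₀
  -- Empirical measures need nonempty sets for every index; raising `x` to at least 1 ensures this
  -- and is eventually invisible.
  have hE : ∀ x : ℚ, (elts N (max x 1 : ℝ)).Nonempty := fun x =>
    ⟨0, by simp [hf.mem_elts, mnorm_zero]⟩
  have hmax : ∀ᶠ x : ℚ in toInfinity X, (max x 1 : ℝ) = x := by
    filter_upwards [tendsto_toInfinity_cast.eventually_ge_atTop 1] with x hx
    exact max_eq_left hx
  refine (tendsto_card_filter_le hE (g := fun x m =>
    ((omega m : ℝ) - Real.log (Real.log x)) / √(Real.log (Real.log x))) (fun t => ?_) a).congr' ?_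
  · refine (tendsto_charFun_omega hN hX hstar p₀ t).congr' ?_
    filter_upwards [hmax] with x hx
    rw [hx, cnt]
  · filter_upwards [hmax] with x hx
    rw [hx, cnt]

end ErdosKacMonoid

/-! ### Transfer to the elements `h • m + b` -/

namespace ErdosKacMonoid

variable {P : Type*} {N : P → ℕ} {X : Set ℚ} {κ θ : ℝ}

lemma sqrt_le_sqrt_add {l l' K : ℝ} (hl : 1 ≤ l) (hK : 0 ≤ K) (h : l' ≤ l + K) : √l' ≤ √l + K := by
  have h1 : 1 ≤ √l := Real.one_le_sqrt.2 hl
  refine Real.sqrt_le_iff.2 ⟨by positivity, ?_⟩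
  nlinarith [Real.sq_sqrt (by linarith : 0 ≤ l)]

lemma abs_mul_sqrt_sub_le {l l' K a : ℝ} (hl : 1 ≤ l) (hK : 0 ≤ K) (h1 : l ≤ l') (h2 : l' ≤ l + K) :
    |a * √l' - a * √l| ≤ |a| * K := by
  have h3 := sqrt_le_sqrt_add hl hK h2
  have h4 := Real.sqrt_le_sqrt h1
  rw [← mul_sub, abs_mul, abs_of_nonneg (sub_nonneg.2 h4)]
  gcongr
  linarith

lemma omega_nsmul_add {h : ℕ} (hh : h ≠ 0) (m b : FreeAbMonoid P) :
    omega m ≤ omega (h • m + b) ∧ omega (h • m + b) ≤ omega m + omega b := by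
  classical
  have hs : (h • m + b).support = m.support ∪ b.support := by
    ext p
    simp only [Finsupp.mem_support_iff, Finsupp.add_apply, Finsupp.smul_apply, smul_eq_mul,
      Finset.mem_union, ne_eq, Nat.add_eq_zero_iff, mul_eq_zero, hh, false_or]
    tauto
  rw [omega, omega, omega, hs]
  exact ⟨Finset.card_le_card Finset.subset_union_left, Finset.card_union_le _ _⟩

/-- Since h ≥ 2 and N(m) > √x, the norm of `h • m + b` lies between x and x^(h + 1). -/
lemma loglog_mnorm_nsmul_add (hN : ∀ p, 1 < N p) {h : ℕ} (hh : 2 ≤ h) {m b : FreeAbMonoid P} {x : ℝ}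
    (hx : 3 ≤ x) (hm : (mnorm N m : ℝ) ≤ x) (hm' : √x < mnorm N m) (hb : (mnorm N b : ℝ) ≤ x) :
    3 ≤ mnorm N (h • m + b) ∧ Real.log (Real.log x) ≤ Real.log (Real.log (mnorm N (h • m + b))) ∧
      Real.log (Real.log (mnorm N (h • m + b))) ≤ Real.log (Real.log x) + Real.log (h + 1) := by
  have hm1 := one_le_mnorm hN m
  have hb1 := one_le_mnorm hN b
  have hM : (mnorm N (h • m + b) : ℝ) = (mnorm N m : ℝ) ^ h * mnorm N b := by
    rw [mnorm_add, mnorm_nsmul]; push_cast; rfl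
  have hlow : x ≤ mnorm N (h • m + b) := by
    rw [hM]
    calc x = √x ^ 2 := (Real.sq_sqrt (by linarith)).symm
      _ ≤ (mnorm N m : ℝ) ^ 2 := by gcongr
      _ ≤ (mnorm N m : ℝ) ^ h := pow_le_pow_right₀ hm1 hh
      _ ≤ _ := le_mul_of_one_le_right (by positivity) hb1
  have hL : 0 < Real.log x := Real.log_pos (by linarith)
  have h1 : Real.log x ≤ Real.log (mnorm N (h • m + b)) := Real.log_le_log (by linarith) hlow
  have h2 : Real.log (mnorm N (h • m + b)) ≤ (h + 1) * Real.log x := by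
    rw [← Nat.cast_add_one, ← Real.log_pow]
    refine Real.log_le_log (by linarith) ?_
    rw [hM, pow_succ]
    gcongr
  refine ⟨by exact_mod_cast hx.trans hlow, Real.log_le_log hL h1, ?_⟩
  rw [add_comm (Real.log (Real.log x)), ← Real.log_mul (by positivity) hL.ne']
  exact Real.log_le_log (by linarith) h2

lemma tendsto_cnt_sqrt_div (hN : ∀ p, 1 < N p) (hX : IsAdmissible N X)
    (hstar : Star N X κ θ) (p₀ : P) :
    Tendsto (fun x : ℚ => cnt N √x / cnt N x) (toInfinity X) (𝓝 0) := by
  obtain ⟨C, hC0, hC⟩ := hstar.cnt_le hN hX p₀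
  obtain ⟨c, hc0, hc⟩ := hstar.le_cnt hN hX p₀
  have h1 : Tendsto (fun x : ℚ => C / c * (√(x : ℝ))⁻¹) (toInfinity X) (𝓝 0) := by
    have := ((Real.tendsto_sqrt_atTop.comp
      (tendsto_toInfinity_cast (X := X))).inv_tendsto_atTop).const_mul (C / c)
    rw [mul_zero] at this
    exact this
  refine squeeze_zero' (Eventually.of_forall fun x => div_nonneg (cnt_nonneg _) (cnt_nonneg _)) ?_ h1
  filter_upwards [tendsto_toInfinity_cast.eventually_ge_atTop 1] with x hx
  have hs : 0 < √(x : ℝ) := Real.sqrt_pos.2 (by linarith)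
  have hcx := hc x hx
  rw [div_le_iff₀ (by nlinarith)]
  calc cnt N √x ≤ C * √x := hC _ hs.le
    _ = C / c * (√(x : ℝ))⁻¹ * (c * √x ^ 2) := by field_simp
    _ ≤ _ := by
      rw [Real.sq_sqrt (by linarith)]
      gcongr

/-- The Erdős–Kac theorem along the elements `h • m + b` with fixed `h` and `b`. -/
lemma tendsto_card_deviation_le (hN : ∀ p, 1 < N p) (hX : IsAdmissible N X)
    (hstar : Star N X κ θ) (p₀ : P) {h : ℕ} (hh : 2 ≤ h) (b : FreeAbMonoid P) (a : ℝ) :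
    Tendsto (fun x : ℚ => (((elts N x).filter fun m => 3 ≤ mnorm N (h • m + b) ∧
      deviation N (h • m + b) ≤ a).card : ℝ) / cnt N x) (toInfinity X) (𝓝 (gaussianCDF a)) := by
  classical
  have hf := hstar.locallyFinite hN hX p₀
  have hl := tendsto_loglog_toInfinity (X := X)
  have hr := tendsto_cnt_sqrt_div hN hX hstar p₀
  set K := Real.log (h + 1) with hK
  have hK0 : 0 ≤ K := Real.log_nonneg (by norm_cast; omega)
  -- Sandwich: elements of norm at most √x are discarded, and for the others the change of centring,
  -- scaling and ω is absorbed by moving the threshold by ε.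
  have hev : ∀ ε : ℝ, 0 < ε → ∀ᶠ x : ℚ in toInfinity X,
      (((elts N x).filter fun m => ((omega m : ℝ) - Real.log (Real.log x)) /
          √(Real.log (Real.log x)) ≤ a - ε).card : ℝ) / cnt N x - cnt N √x / cnt N x ≤
        (((elts N x).filter fun m => 3 ≤ mnorm N (h • m + b) ∧
          deviation N (h • m + b) ≤ a).card : ℝ) / cnt N x ∧
      (((elts N x).filter fun m => 3 ≤ mnorm N (h • m + b) ∧
          deviation N (h • m + b) ≤ a).card : ℝ) / cnt N x ≤
        (((elts N x).filter fun m => ((omega m : ℝ) - Real.log (Real.log x)) /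
          √(Real.log (Real.log x)) ≤ a + ε).card : ℝ) / cnt N x + cnt N √x / cnt N x := by
    intro ε hε
    filter_upwards [tendsto_toInfinity_cast.eventually_ge_atTop 3, hl.eventually_ge_atTop 1,
      tendsto_toInfinity_cast.eventually_ge_atTop (mnorm N b : ℝ),
      -- The total shift is at most K from the centre, |a| K from the scale and ω(b) from the new
      -- primes; this makes it at most ε√l.
      (Real.tendsto_sqrt_atTop.comp hl).eventually_ge_atTop ((K + |a| * K + omega b) / ε)]
      with x hx hlx hbx hs
    simp only [Function.comp_apply] at hs
    rw [div_le_iff₀ hε] at hs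
    set l := Real.log (Real.log (x : ℝ)) with hldef
    have hs0 : 0 < √l := Real.sqrt_pos.2 (by linarith)
    have hob : (0 : ℝ) ≤ omega b := Nat.cast_nonneg _
    have haK : 0 ≤ |a| * K := by positivity
    have key : ∀ m ∈ elts N x, m ∉ elts N √x →
        (((omega m : ℝ) - l) / √l ≤ a - ε →
          3 ≤ mnorm N (h • m + b) ∧ deviation N (h • m + b) ≤ a) ∧
        (deviation N (h • m + b) ≤ a → ((omega m : ℝ) - l) / √l ≤ a + ε) := by
      intro m hm hm'
      rw [hf.mem_elts] at hm hm'
      obtain ⟨h3, h1, h2⟩ := loglog_mnorm_nsmul_add hN hh hx hm (not_le.1 hm') hbx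
      obtain ⟨ho1, ho2⟩ := omega_nsmul_add (by omega : h ≠ 0) m b
      have ho1' : (omega m : ℝ) ≤ omega (h • m + b) := by exact_mod_cast ho1
      have ho2' : (omega (h • m + b) : ℝ) ≤ omega m + omega b := by exact_mod_cast ho2
      rw [deviation]
      set l' := Real.log (Real.log (mnorm N (h • m + b)))
      have hs0' : 0 < √l' := Real.sqrt_pos.2 (by linarith)
      have h4 := abs_le.1 (abs_mul_sqrt_sub_le (a := a) hlx hK0 h1 h2)
      rw [div_le_iff₀ hs0, div_le_iff₀ hs0', div_le_iff₀ hs0]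
      refine ⟨fun h5 => ⟨h3, ?_⟩, fun h5 => ?_⟩
      · linarith
      · linarith
    constructor
    · rw [← sub_div]
      gcongr
      · exact cnt_nonneg _
      rw [sub_le_iff_le_add, cnt]
      norm_cast
      refine le_trans (Finset.card_le_card fun m hm => ?_) (Finset.card_union_le _ _)
      rw [Finset.mem_filter] at hm
      rw [Finset.mem_union, Finset.mem_filter, or_iff_not_imp_right]
      exact fun hm' => ⟨hm.1, (key m hm.1 hm').1 hm.2⟩
    · rw [← add_div]
      gcongr
      · exact cnt_nonneg _
      rw [cnt]
      norm_cast
      refine le_trans (Finset.card_le_card fun m hm => ?_) (Finset.card_union_le _ _)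
      rw [Finset.mem_filter] at hm
      rw [Finset.mem_union, Finset.mem_filter, or_iff_not_imp_right]
      exact fun hm' => ⟨hm.1, (key m hm.1 hm').2 hm.2.2⟩
  have hcont := continuous_gaussianCDF.tendsto a
  refine tendsto_order.2 ⟨fun u hu => ?_, fun u hu => ?_⟩
  · obtain ⟨r, hr0, hball⟩ := Metric.eventually_nhds_iff.1 (hcont.eventually_const_lt hu)
    have h1 := hball (y := a - r / 2) (by rw [Real.dist_eq, abs_of_nonpos] <;> linarith)
    have h2 := (tendsto_card_omega_le hN hX hstar p₀ (a - r / 2)).sub hr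
    rw [sub_zero] at h2
    filter_upwards [hev (r / 2) (by linarith), h2.eventually_const_lt h1] with x hx hx'
    exact hx'.trans_le hx.1
  · obtain ⟨r, hr0, hball⟩ := Metric.eventually_nhds_iff.1 (hcont.eventually_lt_const hu)
    have h1 := hball (y := a + r / 2) (by rw [Real.dist_eq, abs_of_nonneg] <;> linarith)
    have h2 := (tendsto_card_omega_le hN hX hstar p₀ (a + r / 2)).add hr
    rw [add_zero] at h2
    filter_upwards [hev (r / 2) (by linarith), h2.eventually_lt_const h1] with x hx hx'
    exact hx.2.trans_lt hx'

end ErdosKacMonoid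

/-! ### Decomposition of `h`-full elements and the Euler product of `γ_h` -/

namespace ErdosKacMonoid

section EulerProduct

variable {P : Type*}

lemma sum_finsupp_prod_eq (w : P → ℕ → ℝ) (K : Finset ℕ) (S : Finset P) :
    ∑ b ∈ S.finsupp (fun _ => K), ∏ p ∈ S, w p (b p) = ∏ p ∈ S, ∑ k ∈ K, w p k := by
  classical
  rw [Finset.prod_sum, Finset.finsupp, Finset.sum_map]
  refine Finset.sum_congr (by congr!) fun φ _ => ?_
  rw [← Finset.prod_attach]
  refine Finset.prod_congr rfl fun p _ => ?_
  simp [Finsupp.indicator_apply]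

open scoped Classical in
/-- An Euler product with finitely many terms in each factor. -/
lemma hasSum_prod_support {w : P → ℕ → ℝ} (hw : ∀ p k, 0 ≤ w p k) {K : Finset ℕ} (hK : 0 ∉ K)
    (hs : Summable fun p => ∑ k ∈ K, w p k) :
    HasSum (fun b : P →₀ ℕ => if ∀ p, b p ≠ 0 → b p ∈ K then ∏ p ∈ b.support, w p (b p) else 0)
      (∏' p, (1 + ∑ k ∈ K, w p k)) := by
  set f : (P →₀ ℕ) → ℝ := fun b =>
    if ∀ p, b p ≠ 0 → b p ∈ K then ∏ p ∈ b.support, w p (b p) else 0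
  have hf0 : ∀ b, 0 ≤ f b := fun b => by
    simp only [f]
    split_ifs
    · exact Finset.prod_nonneg fun p _ => hw _ _
    · exact le_rfl
  have hsum := summable_finsetProd_of_summable_nonneg
    (fun p => Finset.sum_nonneg fun k _ => hw p k) hs
  -- Group the elements by support: each fibre is a finite product of sums, with 0 ∉ K making the
  -- support exactly `S`; expanding the infinite product then sums over `S`.
  have hfib : ∀ S : Finset P,
      HasSum (fun b : {b : P →₀ ℕ // b.support = S} => f b) (∏ p ∈ S, ∑ k ∈ K, w p k) := by
    intro S
    refine (hasSum_subtype_iff_indicator (f := f) (s := {b : P →₀ ℕ | b.support = S})).2 ?_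
    rw [← sum_finsupp_prod_eq]
    have h1 : ∑ b ∈ S.finsupp (fun _ => K), ∏ p ∈ S, w p (b p) =
        ∑ b ∈ S.finsupp (fun _ => K), Set.indicator {b : P →₀ ℕ | b.support = S} f b := by
      refine Finset.sum_congr rfl fun b hb => ?_
      rw [Finset.mem_finsupp_iff] at hb
      have hS : b.support = S := hb.1.antisymm fun p hp =>
        Finsupp.mem_support_iff.2 fun h0 => hK (h0 ▸ hb.2 p hp)
      rw [Set.indicator_of_mem (show b ∈ {b : P →₀ ℕ | b.support = S} from hS)]
      simp only [f]
      rw [if_pos fun p hp => hb.2 p (hb.1 (Finsupp.mem_support_iff.2 hp)), hS]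
    rw [h1]
    refine hasSum_sum_of_ne_finset_zero fun b hb => ?_
    by_cases hS : b.support = S
    · rw [Set.indicator_of_mem (show b ∈ {b : P →₀ ℕ | b.support = S} from hS)]
      refine if_neg fun h => hb (Finset.mem_finsupp_iff.2 ⟨hS.le, fun p hp => ?_⟩)
      exact h p (Finsupp.mem_support_iff.1 (hS ▸ hp))
    · exact Set.indicator_of_notMem (s := {b : P →₀ ℕ | b.support = S}) hS f
  rw [tprod_one_add hsum, ← (Equiv.sigmaFiberEquiv (Finsupp.support : (P →₀ ℕ) → Finset P)).hasSum_iff]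
  refine HasSum.sigma_of_hasSum hsum.hasSum hfib ?_
  refine (summable_sigma_of_nonneg fun _ => hf0 _).2 ⟨fun S => (hfib S).summable, ?_⟩
  exact hsum.congr fun S => ((hfib S).tsum_eq).symm

end EulerProduct

section Decomposition

variable {P : Type*} {N : P → ℕ}

/-- The part of an `h`-full exponent not absorbed by an `h`-th power. -/
def restPart (h n : ℕ) : ℕ := if n % h = 0 then 0 else h + n % h

/-- The part of an `h`-full element not absorbed by an `h`-th power. -/
noncomputable def rest (h : ℕ) (m : FreeAbMonoid P) : FreeAbMonoid P :=
  m.mapRange (restPart h) (by simp [restPart])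

/-- All nonzero exponents lie strictly between `h` and `2 * h`. -/
def IsRest (h : ℕ) (b : FreeAbMonoid P) : Prop := ∀ p, b p ≠ 0 → b p ∈ Finset.Ioo h (2 * h)

lemma restPart_mul_add {h : ℕ} (a : ℕ) {n : ℕ} (hn : n ≠ 0 → n ∈ Finset.Ioo h (2 * h)) :
    restPart h (h * a + n) = n := by
  rw [restPart, Nat.mul_add_mod]
  by_cases h0 : n = 0
  · simp [h0]
  · have h1 := Finset.mem_Ioo.1 (hn h0)
    have h2 : n % h = n - h := by
      rw [Nat.mod_eq_sub_mod h1.1.le, Nat.mod_eq_of_lt (by omega)]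
    rw [h2, if_neg (by omega)]
    omega

lemma rest_nsmul_add {h : ℕ} (a : FreeAbMonoid P) {b : FreeAbMonoid P} (hb : IsRest h b) :
    rest h (h • a + b) = b := by
  ext p
  simp [rest, restPart_mul_add (a p) (hb p)]

lemma isFull_nsmul_add {h : ℕ} (a : FreeAbMonoid P) {b : FreeAbMonoid P} (hb : IsRest h b) :
    IsFull h (h • a + b) := fun p hp => by
  rw [Finsupp.add_apply, Finsupp.smul_apply, smul_eq_mul] at *
  by_cases h0 : b p = 0
  · have ha : 1 ≤ a p := Nat.one_le_iff_ne_zero.2 fun h1 => hp (by simp [h0, h1])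
    nlinarith
  · have := Finset.mem_Ioo.1 (hb p h0)
    nlinarith [Nat.zero_le (h * a p)]

lemma isRest_rest {h : ℕ} (hh : h ≠ 0) (m : FreeAbMonoid P) : IsRest h (rest h m) := fun p => by
  rw [rest, Finsupp.mapRange_apply, restPart, Finset.mem_Ioo]
  have := Nat.mod_lt (m p) (Nat.pos_of_ne_zero hh)
  split_ifs <;> omega

/-- For an exponent hq + r with 0 < r < h, fullness gives q ≥ 1, so it equals h(q - 1) + (h + r);
this is why the remainder is taken above `h`. -/
lemma IsFull.exists_eq_nsmul_add {h : ℕ} (hh : h ≠ 0) {m : FreeAbMonoid P} (hm : IsFull h m) :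
    ∃ a : FreeAbMonoid P, h • a + rest h m = m := by
  refine ⟨(m - rest h m).mapRange (· / h) (by simp), ?_⟩
  ext p
  rw [Finsupp.add_apply, Finsupp.smul_apply, Finsupp.mapRange_apply, Finsupp.tsub_apply, rest,
    Finsupp.mapRange_apply, smul_eq_mul, restPart]
  have hlt := Nat.mod_lt (m p) (Nat.pos_of_ne_zero hh)
  have hdm := Nat.div_add_mod (m p) h
  split_ifs with h0
  · rw [Nat.sub_zero, add_zero]
    omega
  · have hmp := hm p (fun h1 => h0 (by simp [h1]))
    have hq : 1 ≤ m p / h := (Nat.one_le_div_iff (Nat.pos_of_ne_zero hh)).2 hmp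
    obtain ⟨q, hq'⟩ := Nat.exists_eq_add_of_le hq
    have h2 : m p - (h + m p % h) = h * q := by
      rw [hq'] at hdm
      rw [mul_add, mul_one] at hdm
      omega
    rw [h2, Nat.mul_div_cancel_left _ (Nat.pos_of_ne_zero hh), ← h2]
    rw [hq', mul_add, mul_one] at hdm
    omega

open scoped Classical in
/-- The `h`-full elements of norm at most `x` with a given property, counted through the
decomposition `m = h • a + b`. -/
lemma ncard_full_eq_tsum (hN : ∀ p, 1 < N p) (hf : LocallyFinite N) {h : ℕ} (hh : h ≠ 0) {x : ℚ}
    (hx : 0 ≤ x) (Q : FreeAbMonoid P → Prop) :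
    (({m ∈ fullUpTo N h x | Q m}.ncard : ℕ) : ℝ) =
      ∑' b : FreeAbMonoid P, if IsRest h b then
        (((elts N ((x / mnorm N b : ℝ) ^ (1 / (h : ℝ)))).filter fun a => Q (h • a + b)).card : ℝ)
      else 0 := by
  set T := (elts N x).filter fun m => IsFull h m ∧ Q m with hT
  have hset : {m ∈ fullUpTo N h x | Q m} = (T : Set (FreeAbMonoid P)) := by
    ext m
    simp only [hT, fullUpTo, Set.mem_ofPred_eq, Finset.coe_filter, hf.mem_elts]
    have : (mnorm N m : ℚ) ≤ x ↔ (mnorm N m : ℝ) ≤ x := by exact_mod_cast Iff.rfl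
    tauto
  rw [hset, Set.ncard_coe_finset]
  have hxr : (0 : ℝ) ≤ x := by exact_mod_cast hx
  have hmem : ∀ a b : FreeAbMonoid P,
      a ∈ elts N ((x / mnorm N b : ℝ) ^ (1 / (h : ℝ))) ↔ h • a + b ∈ elts N x := fun a b => by
    have hb : (0 : ℝ) < mnorm N b := by exact_mod_cast mnorm_pos hN b
    rw [hf.mem_elts, hf.mem_elts, mnorm_add, mnorm_nsmul, one_div,
      Real.le_rpow_inv_iff_of_pos (by positivity) (by positivity) (by positivity),
      Real.rpow_natCast, le_div_iff₀ hb]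
    push_cast
    rfl
  have hfib : ∀ b : FreeAbMonoid P, (if IsRest h b then
        (((elts N ((x / mnorm N b : ℝ) ^ (1 / (h : ℝ)))).filter fun a => Q (h • a + b)).card : ℝ)
      else 0) = ((T.filter fun m => rest h m = b).card : ℝ) := fun b => by
    split_ifs with hb
    · rw [Nat.cast_inj]
      refine Finset.card_bij (fun a _ => h • a + b) (fun a ha => ?_) (fun a _ a' _ haa => ?_)
        fun m hm => ?_
      · rw [Finset.mem_filter, hmem] at ha
        rw [Finset.mem_filter, hT, Finset.mem_filter]
        exact ⟨⟨ha.1, isFull_nsmul_add a hb, ha.2⟩, rest_nsmul_add a hb⟩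
      · have h1 := add_right_cancel haa
        ext p
        have h2 := DFunLike.congr_fun h1 p
        simpa [hh] using h2
      · rw [Finset.mem_filter, hT, Finset.mem_filter] at hm
        obtain ⟨⟨hm1, hm2, hm3⟩, rfl⟩ := hm
        obtain ⟨a, ha⟩ := hm2.exists_eq_nsmul_add hh
        refine ⟨a, ?_, ha⟩
        rw [Finset.mem_filter, hmem, ha]
        exact ⟨hm1, hm3⟩
    · symm
      rw [Nat.cast_eq_zero, Finset.card_eq_zero, Finset.filter_eq_empty_iff]
      rintro m - rfl
      exact hb (isRest_rest hh m)
  -- Only finitely many remainders occur, so the series is a finite sum over fibres.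
  rw [tsum_congr hfib, tsum_eq_sum (s := T.image (rest h))]
  · rw [← Nat.cast_sum, ← Finset.card_eq_sum_card_image]
  · intro b hb
    rw [Nat.cast_eq_zero, Finset.card_eq_zero, Finset.filter_eq_empty_iff]
    exact fun m hm hmb => hb (Finset.mem_image.2 ⟨m, hm, hmb⟩)

end Decomposition

section Constant

variable {P : Type*} {N : P → ℕ}

/-- A geometric sum of ratio N(p)^(-1/h). In this form each exponent k/h exceeds 1, which yields
convergence. -/
lemma gammaFactor_eq (hN : ∀ p, 1 < N p) {h : ℕ} (hh : 2 ≤ h) (p : P) :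
    gammaFactor N h p = 1 + ∑ k ∈ Finset.Ioo h (2 * h), (N p : ℝ) ^ (-(k / h : ℝ)) := by
  have hn : (1 : ℝ) < N p := by exact_mod_cast hN p
  have hn0 : (0 : ℝ) < N p := by linarith
  have hh0 : (h : ℝ) ≠ 0 := by positivity
  rw [gammaFactor]
  congr 1
  set r := (N p : ℝ) ^ (1 / (h : ℝ)) with hr
  have hr1 : 1 < r := Real.one_lt_rpow hn (by positivity)
  have hr0 : 0 < r := by linarith
  have hrh : r ^ h = N p := by
    rw [hr, ← Real.rpow_natCast, ← Real.rpow_mul hn0.le, one_div_mul_cancel hh0, Real.rpow_one]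
  have hk : ∀ k : ℕ, (N p : ℝ) ^ (-(k / h : ℝ)) = r⁻¹ ^ k := fun k => by
    rw [Real.rpow_neg hn0.le, inv_pow, hr, ← Real.rpow_natCast, ← Real.rpow_mul hn0.le]
    congr 2
    ring
  simp_rw [hk]
  have hIoo : Finset.Ioo h (2 * h) = Finset.Ico (h + 1) (2 * h) := by
    ext k; simp only [Finset.mem_Ioo, Finset.mem_Ico]; omega
  rw [hIoo, geom_sum_Ico (inv_lt_one_of_one_lt₀ hr1).ne (by omega), ← hrh]
  have h1 : r - 1 ≠ 0 := by linarith
  have h2 : r⁻¹ - 1 ≠ 0 := by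
    have := inv_lt_one_of_one_lt₀ hr1
    linarith
  rw [div_eq_div_iff (mul_ne_zero (by positivity) h1) h2]
  have e1 : r⁻¹ ^ (2 * h) = (r ^ h)⁻¹ ^ 2 := by rw [inv_pow, inv_pow, ← pow_mul, mul_comm]
  have e2 : r⁻¹ ^ (h + 1) = (r ^ h)⁻¹ * r⁻¹ := by rw [pow_succ, inv_pow]
  have h3 : r ^ h ≠ 0 := by positivity
  rw [e1, e2]
  generalize r ^ h = y at *
  field_simp
  ring

lemma summable_gammaFactor_sub_one (hN : ∀ p, 1 < N p) (hf : LocallyFinite N) {C : ℝ}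
    (hC : ∀ z : ℝ, 0 ≤ z → cnt N z ≤ C * z) {h : ℕ} (hh : 2 ≤ h) :
    Summable fun p => ∑ k ∈ Finset.Ioo h (2 * h), (N p : ℝ) ^ (-(k / h : ℝ)) := by
  refine summable_sum fun k hk => summable_prime_rpow_neg hN hf hC ?_
  have hh0 : (0 : ℝ) < h := by positivity
  rw [one_lt_div hh0]
  exact_mod_cast (Finset.mem_Ioo.1 hk).1

lemma multipliable_gammaFactor (hN : ∀ p, 1 < N p) (hf : LocallyFinite N) {C : ℝ}
    (hC : ∀ z : ℝ, 0 ≤ z → cnt N z ≤ C * z) {h : ℕ} (hh : 2 ≤ h) :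
    Multipliable (gammaFactor N h) := by
  rw [funext (gammaFactor_eq hN hh)]
  exact Real.multipliable_one_add_of_summable (summable_gammaFactor_sub_one hN hf hC hh)

open scoped Classical in
lemma hasSum_gammaConst (hN : ∀ p, 1 < N p) (hf : LocallyFinite N) {C : ℝ}
    (hC : ∀ z : ℝ, 0 ≤ z → cnt N z ≤ C * z) {h : ℕ} (hh : 2 ≤ h) :
    HasSum (fun b : FreeAbMonoid P => if IsRest h b then ((mnorm N b : ℝ) ^ (1 / (h : ℝ)))⁻¹ else 0)
      (gammaConst N h) := by
  rw [gammaConst, funext (gammaFactor_eq hN hh)]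
  have := hasSum_prod_support (w := fun p k => (N p : ℝ) ^ (-(k / h : ℝ)))
    (fun p k => by positivity) (K := Finset.Ioo h (2 * h)) (by simp)
    (summable_gammaFactor_sub_one hN hf hC hh)
  convert this using 2 with b
  simp only [IsRest]
  congr 1
  rw [mnorm, Finsupp.prod, Nat.cast_prod, ← Real.finsetProd_rpow _ _ fun _ _ => by positivity,
    ← Finset.prod_inv_distrib]
  refine Finset.prod_congr rfl fun p _ => ?_
  rw [Nat.cast_pow, ← Real.rpow_natCast, ← Real.rpow_mul (by positivity),
    ← Real.rpow_neg (by positivity)]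
  congr 1
  ring

end Constant

end ErdosKacMonoid

/-! ### Summation over remainders by dominated convergence -/

namespace ErdosKacMonoid

variable {P : Type*} {N : P → ℕ} {X : Set ℚ} {κ θ : ℝ}

/-- The number of `a` with a given property for which `h • a + b` has norm at most `x`,
for admissible `b`. -/
noncomputable def restCount (N : P → ℕ) (h : ℕ) (Q : FreeAbMonoid P → Prop) (x : ℚ)
    (b : FreeAbMonoid P) : ℝ :=
  open scoped Classical in
  if IsRest h b then
    (((elts N ((x / mnorm N b : ℝ) ^ (1 / (h : ℝ)))).filter fun a => Q (h • a + b)).card : ℝ)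
  else 0

/-- The summands of the series for `γ_h`. -/
noncomputable def restWeight (N : P → ℕ) (h : ℕ) (b : FreeAbMonoid P) : ℝ :=
  open scoped Classical in
  if IsRest h b then ((mnorm N b : ℝ) ^ (1 / (h : ℝ)))⁻¹ else 0

lemma restCount_nonneg (h : ℕ) (Q : FreeAbMonoid P → Prop) (x : ℚ) (b : FreeAbMonoid P) :
    0 ≤ restCount N h Q x b := by
  rw [restCount]
  split_ifs <;> positivity

/-- The domination for both limits: after division by x^(1/h) the bound is summable in `b` and free
of `x`. -/
lemma restCount_le {C : ℝ} (hC : ∀ z : ℝ, 0 ≤ z → cnt N z ≤ C * z) {h : ℕ}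
    (Q : FreeAbMonoid P → Prop) {x : ℚ} (hx : 0 ≤ x) (b : FreeAbMonoid P) :
    restCount N h Q x b ≤ C * restWeight N h b * (x : ℝ) ^ (1 / (h : ℝ)) := by
  classical
  have hxr : (0 : ℝ) ≤ x := by exact_mod_cast hx
  rw [restCount, restWeight]
  split_ifs
  · refine le_trans (Nat.cast_le.2 (Finset.card_filter_le _ _)) ?_
    refine (hC _ (by positivity)).trans (le_of_eq ?_)
    rw [Real.div_rpow hxr (by positivity)]
    ring
  · simp

lemma isRest_zero (h : ℕ) : IsRest h (0 : FreeAbMonoid P) := fun _ hp => absurd rfl hp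

lemma restWeight_nonneg (h : ℕ) (b : FreeAbMonoid P) : 0 ≤ restWeight N h b := by
  rw [restWeight]
  split_ifs <;> positivity

lemma tendsto_toInfinity_div_root (hN : ∀ p, 1 < N p) {h : ℕ} (hh : 2 ≤ h) (b : FreeAbMonoid P) :
    Tendsto (fun x : ℚ => (x / mnorm N b : ℝ) ^ (1 / (h : ℝ))) (toInfinity X) atTop := by
  have hb : (0 : ℝ) < mnorm N b := by exact_mod_cast mnorm_pos hN b
  exact (tendsto_rpow_atTop (by positivity)).comp (tendsto_toInfinity_cast.atTop_div_const hb)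

/-- The term `b = 0` already has order x^(1/h). For general `X` this replaces an asymptotic formula
for the number of `h`-full elements. -/
lemma le_tsum_restCount {c : ℝ}
    (hc : ∀ z : ℝ, 1 ≤ z → c * z ≤ cnt N z) {h : ℕ} (hh : 2 ≤ h) {x : ℚ} (hx : 1 ≤ x)
    (hs : Summable (restCount N h (fun _ => True) x)) :
    c * (x : ℝ) ^ (1 / (h : ℝ)) ≤ ∑' b, restCount N h (fun _ => True) x b := by
  have hxr : (1 : ℝ) ≤ x := by exact_mod_cast hx
  refine (hc _ (Real.one_le_rpow hxr (by positivity))).trans ?_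
  refine le_trans (le_of_eq ?_) (hs.le_tsum 0 fun b _ => restCount_nonneg _ _ _ _)
  rw [restCount, if_pos (isRest_zero h), mnorm_zero]
  simp [cnt]

lemma summable_restWeight (hN : ∀ p, 1 < N p) (hf : LocallyFinite N) {C : ℝ}
    (hC : ∀ z : ℝ, 0 ≤ z → cnt N z ≤ C * z) {h : ℕ} (hh : 2 ≤ h) : Summable (restWeight N h) :=
  (hasSum_gammaConst hN hf hC hh).summable

lemma summable_restCount (hN : ∀ p, 1 < N p) (hf : LocallyFinite N) {C : ℝ}
    (hC : ∀ z : ℝ, 0 ≤ z → cnt N z ≤ C * z) {h : ℕ} (hh : 2 ≤ h) (Q : FreeAbMonoid P → Prop)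
    {x : ℚ} (hx : 0 ≤ x) : Summable (restCount N h Q x) :=
  (((summable_restWeight hN hf hC hh).mul_left C).mul_right _).of_nonneg_of_le
    (restCount_nonneg h Q x) (restCount_le hC Q hx)

/-- A difference is used instead of a ratio so that it can be summed over `b`. The bound (x /
N(b))^(1/h) need not lie in `X`, so the limit law is applied at the largest norm below it. -/
lemma tendsto_restCount_sub (hN : ∀ p, 1 < N p) (hX : IsAdmissible N X)
    (hstar : Star N X κ θ) (p₀ : P) {h : ℕ} (hh : 2 ≤ h) (a : ℝ) (b : FreeAbMonoid P) :
    Tendsto (fun x : ℚ =>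
      (restCount N h (fun m => 3 ≤ mnorm N m ∧ deviation N m ≤ a) x b -
        gaussianCDF a * restCount N h (fun _ => True) x b) / (x : ℝ) ^ (1 / (h : ℝ)))
      (toInfinity X) (𝓝 0) := by
  classical
  by_cases hb : IsRest h b
  swap
  · simpa [restCount, hb] using tendsto_const_nhds
  have hf := hstar.locallyFinite hN hX p₀
  obtain ⟨C, hC0, hC⟩ := hstar.cnt_le hN hX p₀
  obtain ⟨ν, hν1, hν2⟩ := hf.exists_norm_floor hN hX p₀
  have hz := tendsto_toInfinity_div_root (X := X) hN hh b
  have h1 := ((tendsto_card_deviation_le hN hX hstar p₀ hh b a).comp (hν2.comp hz)).sub_const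
    (gaussianCDF a)
  rw [sub_self] at h1
  have h2 := h1.norm.mul_const (C * restWeight N h b)
  rw [norm_zero, zero_mul] at h2
  refine squeeze_zero_norm' ?_ h2
  filter_upwards [hz.eventually_ge_atTop 1, tendsto_toInfinity_cast.eventually_gt_atTop 0]
    with x hx hx0
  have hr : 0 < (x : ℝ) ^ (1 / (h : ℝ)) := by positivity
  have h3 := restCount_le hC (h := h) (fun _ => True) (x := x) (by exact_mod_cast hx0.le) b
  simp only [Function.comp_apply, cnt, hν1 _ hx]
  have h4 : restCount N h (fun _ => True) x b =
      ((elts N ((x / mnorm N b : ℝ) ^ (1 / (h : ℝ)))).card : ℝ) := by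
    rw [restCount, if_pos hb]
    simp
  have h5 : restCount N h (fun m => 3 ≤ mnorm N m ∧ deviation N m ≤ a) x b =
      (((elts N ((x / mnorm N b : ℝ) ^ (1 / (h : ℝ)))).filter fun m => 3 ≤ mnorm N (h • m + b) ∧
        deviation N (h • m + b) ≤ a).card : ℝ) := by
    rw [restCount, if_pos hb]
    congr!
  have hpos := hf.one_le_cnt hx
  rw [cnt, ← h4] at hpos
  rw [← h5, ← h4]
  set A := restCount N h (fun _ => True) x b
  have h6 : A ≠ 0 := by linarith
  rw [norm_div, Real.norm_of_nonneg hr.le, div_le_iff₀ hr]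
  have h7 : restCount N h (fun m => 3 ≤ mnorm N m ∧ deviation N m ≤ a) x b - gaussianCDF a * A =
      (restCount N h (fun m => 3 ≤ mnorm N m ∧ deviation N m ≤ a) x b / A - gaussianCDF a) * A := by
    field_simp
  rw [h7, norm_mul, Real.norm_of_nonneg (by linarith : 0 ≤ A), mul_assoc]
  gcongr

lemma tendsto_full_deviation (hN : ∀ p, 1 < N p) (hX : IsAdmissible N X)
    (hstar : Star N X κ θ) (p₀ : P) {h : ℕ} (hh : 2 ≤ h) (a : ℝ) :
    Tendsto (fun x : ℚ => (({m ∈ fullUpTo N h x | 3 ≤ mnorm N m ∧ deviation N m ≤ a}.ncard : ℕ) : ℝ) /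
      ((fullUpTo N h x).ncard : ℝ)) (toInfinity X) (𝓝 (gaussianCDF a)) := by
  classical
  have hf := hstar.locallyFinite hN hX p₀
  obtain ⟨C, hC0, hC⟩ := hstar.cnt_le hN hX p₀
  obtain ⟨c, hc0, hc⟩ := hstar.le_cnt hN hX p₀
  set Q : FreeAbMonoid P → Prop := fun m => 3 ≤ mnorm N m ∧ deviation N m ≤ a
  have hG0 : 0 ≤ |gaussianCDF a| := abs_nonneg _
  have htan : Tendsto (fun x : ℚ => ∑' b, (restCount N h Q x b -
      gaussianCDF a * restCount N h (fun _ => True) x b) / (x : ℝ) ^ (1 / (h : ℝ)))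
      (toInfinity X) (𝓝 (∑' _ : FreeAbMonoid P, (0 : ℝ))) := by
    refine tendsto_tsum_of_dominated_convergence
      (bound := fun b => (1 + |gaussianCDF a|) * (C * restWeight N h b))
      (((summable_restWeight hN hf hC hh).mul_left C).mul_left _)
      (fun b => tendsto_restCount_sub hN hX hstar p₀ hh a b) ?_
    filter_upwards [tendsto_toInfinity_cast.eventually_gt_atTop 0] with x hx b
    have hr : 0 < (x : ℝ) ^ (1 / (h : ℝ)) := by positivity
    have hx' : 0 ≤ x := by exact_mod_cast hx.le
    have h1 := restCount_le hC (h := h) Q hx' b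
    have h2 := restCount_le hC (h := h) (fun _ => True) hx' b
    rw [norm_div, Real.norm_of_nonneg hr.le, div_le_iff₀ hr]
    refine (norm_sub_le _ _).trans ?_
    rw [norm_mul, Real.norm_of_nonneg (restCount_nonneg _ _ _ _),
      Real.norm_of_nonneg (restCount_nonneg _ _ _ _), Real.norm_eq_abs]
    nlinarith [mul_le_mul_of_nonneg_left h2 hG0]
  rw [tsum_zero] at htan
  have hmain : Tendsto (fun x : ℚ =>
      (({m ∈ fullUpTo N h x | Q m}.ncard : ℕ) : ℝ) / ((fullUpTo N h x).ncard : ℝ) - gaussianCDF a)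
      (toInfinity X) (𝓝 0) := by
    -- Dividing by the full count instead of x^(1/h) costs at most the factor 1/c.
    have hlim := htan.norm.mul_const c⁻¹
    rw [norm_zero, zero_mul] at hlim
    refine squeeze_zero_norm' ?_ hlim
    filter_upwards [tendsto_toInfinity_cast.eventually_ge_atTop 1] with x hx
    have hx1 : (1 : ℚ) ≤ x := by exact_mod_cast hx
    have hx0 : (0 : ℚ) ≤ x := by linarith
    have hr : 0 < (x : ℝ) ^ (1 / (h : ℝ)) := by positivity
    have hs1 := summable_restCount hN hf hC hh Q hx0
    have hs2 := summable_restCount hN hf hC hh (fun _ => True) hx0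
    have h1 : (({m ∈ fullUpTo N h x | Q m}.ncard : ℕ) : ℝ) = ∑' b, restCount N h Q x b :=
      ncard_full_eq_tsum hN hf (by omega) hx0 Q
    have h2 : ((fullUpTo N h x).ncard : ℝ) = ∑' b, restCount N h (fun _ => True) x b := by
      have := ncard_full_eq_tsum hN hf (h := h) (by omega) hx0 (fun _ => True)
      simpa [restCount] using this
    have h3 := le_tsum_restCount hc hh hx1 hs2
    rw [tsum_div_const, hs1.tsum_sub (hs2.mul_left _), tsum_mul_left, ← h1, ← h2]
    rw [← h2] at h3
    have hpos : 0 < ((fullUpTo N h x).ncard : ℝ) := lt_of_lt_of_le (by positivity) h3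
    rw [div_sub' hpos.ne', norm_div, norm_div, Real.norm_of_nonneg hpos.le,
      Real.norm_of_nonneg hr.le, mul_comm _ (gaussianCDF a), ← div_eq_mul_inv, div_div]
    gcongr
    rwa [mul_comm]
  have := hmain.add_const (gaussianCDF a)
  simpa only [sub_add_cancel, zero_add] using this

/-- Norms are integers, so a real argument may be replaced by its floor, a point of `X` here. -/
lemma tendsto_cnt_div_atTop (hstar : Star N Set.univ κ θ) (hf : LocallyFinite N) :
    Tendsto (fun z : ℝ => cnt N z / z) atTop (𝓝 κ) := by
  have h1 : Tendsto (fun z : ℝ => (⌊z⌋₊ : ℚ)) atTop (toInfinity Set.univ) := by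
    rw [toInfinity, principal_univ, inf_top_eq]
    exact tendsto_natCast_atTop_atTop.comp tendsto_nat_floor_atTop
  have h2 := ((hstar.tendsto_cnt_div hf).comp h1).mul (tendsto_nat_floor_div_atTop (R := ℝ))
  rw [mul_one] at h2
  refine h2.congr' ?_
  filter_upwards [eventually_ge_atTop 1] with z hz
  have : (0 : ℝ) < ⌊z⌋₊ := by exact_mod_cast Nat.floor_pos.2 hz
  simp only [Function.comp_apply, Rat.cast_natCast]
  rw [hf.cnt_floor (by linarith)]
  field_simp

lemma isEquivalent_full (hN : ∀ p, 1 < N p) (hX : IsAdmissible N Set.univ)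
    (hstar : Star N Set.univ κ θ) (p₀ : P) {h : ℕ} (hh : 2 ≤ h) :
    (fun x : ℚ => ((fullUpTo N h x).ncard : ℝ)) ~[toInfinity Set.univ]
      fun x : ℚ => κ * gammaConst N h * (x : ℝ) ^ (1 / (h : ℝ)) := by
  classical
  have hf := hstar.locallyFinite hN hX p₀
  obtain ⟨C, hC0, hC⟩ := hstar.cnt_le hN hX p₀
  have hκ := hstar.kappa_pos
  have hγ := hasSum_gammaConst hN hf hC hh
  have hγ1 : 0 < gammaConst N h := by
    have h1 := le_hasSum hγ 0 fun b _ => restWeight_nonneg h b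
    rw [if_pos (isRest_zero h), mnorm_zero] at h1
    simp only [Nat.cast_one, Real.one_rpow, inv_one] at h1
    linarith
  have htan : Tendsto (fun x : ℚ => ∑' b, restCount N h (fun _ => True) x b /
      (x : ℝ) ^ (1 / (h : ℝ))) (toInfinity Set.univ) (𝓝 (∑' b, κ * restWeight N h b)) := by
    refine tendsto_tsum_of_dominated_convergence
      (bound := fun b => C * restWeight N h b)
      ((summable_restWeight hN hf hC hh).mul_left C) (fun b => ?_) ?_
    · by_cases hb : IsRest h b
      swap
      · simpa [restCount, restWeight, hb] using tendsto_const_nhds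
      have h1 := ((tendsto_cnt_div_atTop hstar hf).comp
        (tendsto_toInfinity_div_root (X := Set.univ) hN hh b)).mul_const (restWeight N h b)
      refine h1.congr' ?_
      filter_upwards [tendsto_toInfinity_cast.eventually_gt_atTop 0] with x hx
      have hb0 : (0 : ℝ) < mnorm N b := by exact_mod_cast mnorm_pos hN b
      have hr : 0 < (x : ℝ) ^ (1 / (h : ℝ)) := by positivity
      have hrb : 0 < (mnorm N b : ℝ) ^ (1 / (h : ℝ)) := by positivity
      simp only [restCount, restWeight, if_pos hb, Function.comp_apply, cnt, Finset.filter_true]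
      rw [Real.div_rpow hx.le hb0.le]
      field_simp
    · filter_upwards [tendsto_toInfinity_cast.eventually_gt_atTop 0] with x hx b
      have hr : 0 < (x : ℝ) ^ (1 / (h : ℝ)) := by positivity
      rw [norm_div, Real.norm_of_nonneg hr.le, div_le_iff₀ hr,
        Real.norm_of_nonneg (restCount_nonneg _ _ _ _)]
      exact restCount_le hC _ (by exact_mod_cast hx.le) b
  have hsum : ∑' b, κ * restWeight N h b = κ * gammaConst N h := by
    rw [tsum_mul_left]
    congr 1
    exact hγ.tsum_eq
  rw [hsum] at htan
  have hne : κ * gammaConst N h ≠ 0 := by positivity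
  refine isEquivalent_of_tendsto_one ?_
  have h1 := htan.div_const (κ * gammaConst N h)
  rw [div_self hne] at h1
  refine h1.congr' ?_
  filter_upwards [tendsto_toInfinity_cast.eventually_gt_atTop 0] with x hx
  have hx0 : (0 : ℚ) ≤ x := by exact_mod_cast hx.le
  have h2 : ((fullUpTo N h x).ncard : ℝ) = ∑' b, restCount N h (fun _ => True) x b := by
    have := ncard_full_eq_tsum hN hf (h := h) (by omega) hx0 (fun _ => True)
    simpa [restCount] using this
  rw [Pi.div_apply, tsum_div_const, ← h2, div_div, mul_comm ((x : ℝ) ^ _)]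

end ErdosKacMonoid

theorem theorem1p4 {P : Type*} [Countable P] (N : P → ℕ) (hN : ∀ p : P, 1 < N p)
    (X : Set ℚ) (hX : ErdosKacMonoid.IsAdmissible N X)
    (κ θ : ℝ) (hstar : ErdosKacMonoid.Star N X κ θ) (h : ℕ) (hh : 2 ≤ h) :
    (∀ a : ℝ,
      Tendsto
        (fun x : ℚ =>
          (({m ∈ ErdosKacMonoid.fullUpTo N h x |
              3 ≤ ErdosKacMonoid.mnorm N m ∧ ErdosKacMonoid.deviation N m ≤ a}.ncard : ℕ) : ℝ) /
            ((ErdosKacMonoid.fullUpTo N h x).ncard : ℝ))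
        (ErdosKacMonoid.toInfinity X) (𝓝 (ErdosKacMonoid.gaussianCDF a))) ∧
    Multipliable (ErdosKacMonoid.gammaFactor N h) ∧
    (X = Set.univ →
      (fun x : ℚ => ((ErdosKacMonoid.fullUpTo N h x).ncard : ℝ)) ~[ErdosKacMonoid.toInfinity X]
        fun x : ℚ => κ * ErdosKacMonoid.gammaConst N h * (x : ℝ) ^ (1 / (h : ℝ))) := by
  rcases isEmpty_or_nonempty P with hP | ⟨⟨p₀⟩⟩
  · rw [ErdosKacMonoid.isEmpty_imp_toInfinity_eq_bot hstar]
    exact ⟨fun _ => tendsto_bot, multipliable_empty,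
      fun _ => isLittleO_bot _ _⟩
  · obtain ⟨C, -, hC⟩ := hstar.cnt_le hN hX p₀
    refine ⟨fun a => ErdosKacMonoid.tendsto_full_deviation hN hX hstar p₀ hh a,
      ErdosKacMonoid.multipliable_gammaFactor hN (hstar.locallyFinite hN hX p₀) hC hh, ?_⟩
    rintro rfl
    exact ErdosKacMonoid.isEquivalent_full hN hX hstar p₀ hh
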